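/- Let $A\in GL_k(\mathbb{Z})$ have real eigenvalues $B_1,\dots,B_k$ with $|B_1|<\cdots<|B_j|<1<|B_{j+1}|<\cdots<|B_k|$ and eigenvectors $v_1,\dots,v_k$ forming a basis of $\mathbb{R}^k$; let $0<\lambda<1$ and let $p\colon\mathbb{T}^k=\mathbb{R}^k/\mathbb{Z}^k\to\mathbb{R}$ be $C^{k+1}$. Put $\phi(x)=\sum_{n\ge 0}\lambda^n p(A^{-n}x)$. Fix $i\le j$ with $|B_i|<\lambda$ and a base point $x\in\mathbb{T}^k$, and let $$\phi_i(t)=\phi(x+tv_i),\qquad q_n(t)=p(A^{-n}x+tv_i)\quad(n\in\mathbb{Z}),$$ so that $\phi_i(t)=\sum_{n\ge0}\lambda^n q_n(B_i^{-n}t)$. For $a\in\mathbb{R}$ let $(q_n)_a=\lim_{T\to\infty}\frac1{2T}\int_{-T}^{T}q_n(t)e^{-iat}\,dt$, where $i$ in the exponent is the imaginary unit. The Fourier coefficients of the formal two-sided series $g_i(t)=\sum_{n\in\mathbb{Z}}\lambda^n q_n(B_i^{-n}t)$ are, by definition, $$(g_i)_\sigma=\sum_{n\in\mathbb{Z}}\lambda^n\,(q_n)_{\sigma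 B_i^{n}},\qquad \sigma\in\mathbb{R}\setminus\{0\}.$$ (If $Ax=x$, all $q_n$ equal $q_i(t)=p(x+tv_i)$.) Let $\dim$ denote box dimension (lower and upper box dimensions exist and agree). Theorem. All the limits $(q_n)_a$ exist and the series defining $(g_i)_\sigma$ converges absolutely for every $\sigma\ne0$. Moreover: 1. If $(g_i)_\sigma=0$ for all $\sigma\neq0$, then $\phi_i$ is $C^1$ on $\mathbb{R}$ and its graph over every interval $[a,b]$, $a<b$, has box dimension $1$. 2. Suppose that the coordinates of $v_i$ are linearly independent over $\mathbb{Q}$, or that $x$ is a periodic point of $A$ (for instance $x=0$). If $(g_i)_\sigma\neq0$ for some $\sigma\ne0$, then for every interval $[a,b]$, $a<b$, $$\dim\operatorname{graph}(\phi_i|_{[a,b]})=2-\frac{\ln\lambda}{\ln|B_i|}.$$ -/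

import Mathlib

open Filter Topology

noncomputable section

/-! ## Box dimension -/

/-- `N_δ(X)`: the smallest number of sets of diameter at most `δ` whose union covers `X`. -/
def coveringNum {M : Type*} [PseudoMetricSpace M] (X : Set M) (δ : ℝ) : ℕ :=
  sInf {n : ℕ | ∃ U : Fin n → Set M,
    (∀ j, Metric.ediam (U j) ≤ ENNReal.ofReal δ) ∧ X ⊆ ⋃ j, U j}

/-- Lower box dimension. -/
def lowerBoxDim {M : Type*} [PseudoMetricSpace M] (X : Set M) : EReal :=
  liminf (fun δ : ℝ => ((Real.log (coveringNum X δ) / (-Real.log δ) : ℝ) : EReal)) (𝓝[>] 0)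

/-- Upper box dimension. -/
def upperBoxDim {M : Type*} [PseudoMetricSpace M] (X : Set M) : EReal :=
  limsup (fun δ : ℝ => ((Real.log (coveringNum X δ) / (-Real.log δ) : ℝ) : EReal)) (𝓝[>] 0)

/-- The box dimension of `X` exists and equals `d`. -/
def HasBoxDim {M : Type*} [PseudoMetricSpace M] (X : Set M) (d : ℝ) : Prop :=
  lowerBoxDim X = (d : EReal) ∧ upperBoxDim X = (d : EReal)

/-- The graph of `f` over `[a, b]`, in the Euclidean plane. -/
def graphOver (f : ℝ → ℝ) (a b : ℝ) : Set (EuclideanSpace ℝ (Fin 2)) :=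
  (fun t : ℝ => !₂[t, f t]) '' Set.Icc a b

/-! ## Fourier coefficients of functions on the line -/

/-- The means `(1 / 2T) ∫_{-T}^{T} q(t) e^{-iat} dt`. -/
def fourierMean (q : ℝ → ℝ) (a : ℝ) (T : ℝ) : ℂ :=
  (1 / (2 * T) : ℂ) * ∫ t in (-T)..T, (q t : ℂ) * Complex.exp (-(Complex.I * a * t))

/-- The Fourier coefficient `q_a` of an almost periodic function `q`. -/
def apFourierCoeff (q : ℝ → ℝ) (a : ℝ) : ℂ :=
  limUnder atTop (fourierMean q a)

/-! ## The invariant graph of the skew product and its sub-slices -/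

/-- The projection `ℝ^k → 𝕋^k = ℝ^k / ℤ^k`. -/
def torusProj {k : ℕ} (x : Fin k → ℝ) : UnitAddTorus (Fin k) :=
  fun l => ((x l : ℝ) : UnitAddCircle)

/-- The action of `M ∈ GL_k(ℤ)` on `𝕋^k`. -/
def torusAct {k : ℕ} (M : Matrix.GeneralLinearGroup (Fin k) ℤ) (x : UnitAddTorus (Fin k)) :
    UnitAddTorus (Fin k) :=
  fun l => ∑ m, (M : Matrix (Fin k) (Fin k) ℤ) l m • x m

/-- `φ(x) = ∑_{n ≥ 0} λ^n p(A^{-n} x)`. -/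
def skewPhi {k : ℕ} (A : Matrix.GeneralLinearGroup (Fin k) ℤ) (lam : ℝ)
    (p : UnitAddTorus (Fin k) → ℝ) (x : UnitAddTorus (Fin k)) : ℝ :=
  ∑' n : ℕ, lam ^ n * p (torusAct (A ^ (-(n : ℤ))) x)

/-- The sub-slice `t ↦ φ(x + t w)` through `x` in direction `w`. -/
def subSlice {k : ℕ} (A : Matrix.GeneralLinearGroup (Fin k) ℤ) (lam : ℝ)
    (p : UnitAddTorus (Fin k) → ℝ) (x : UnitAddTorus (Fin k)) (w : Fin k → ℝ) (t : ℝ) : ℝ :=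
  skewPhi A lam p (x + torusProj (t • w))

/-- The restriction `t ↦ p(x + t w)` of `p` to the line through `x` in direction `w`. -/
def lineRestr {k : ℕ} (p : UnitAddTorus (Fin k) → ℝ) (x : UnitAddTorus (Fin k))
    (w : Fin k → ℝ) (t : ℝ) : ℝ :=
  p (x + torusProj (t • w))

/-- The terms, indexed by `n : ℤ`, of the series of the `σ`-th Fourier coefficient of the formal
two-sided series `g(t) = ∑_{n ∈ ℤ} λ^n p(A^{-n}(x + t w)) = ∑_{n ∈ ℤ} λ^n q_n(β^{-n} t)`, where
`A w = β w` and `q_n(t) = p(A^{-n} x + t w)`: the `σ`-th coefficient of `t ↦ q_n(β^{-n} t)` is the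
coefficient of `q_n` at `σ β^n`. If `A x = x` then `q_n(t) = p(x + t w)` for every `n`. -/
def gTerm {k : ℕ} (A : Matrix.GeneralLinearGroup (Fin k) ℤ) (lam : ℝ)
    (p : UnitAddTorus (Fin k) → ℝ) (x : UnitAddTorus (Fin k)) (β : ℝ) (w : Fin k → ℝ)
    (σ : ℝ) (n : ℤ) : ℂ :=
  (lam : ℂ) ^ n * apFourierCoeff (lineRestr p (torusAct (A ^ (-n)) x) w) (σ * β ^ n)

/-- The Fourier coefficient `g_σ = ∑_{n ∈ ℤ} λ^n (q_n)_{σ β^n}`. -/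
def gCoeff {k : ℕ} (A : Matrix.GeneralLinearGroup (Fin k) ℤ) (lam : ℝ)
    (p : UnitAddTorus (Fin k) → ℝ) (x : UnitAddTorus (Fin k)) (β : ℝ) (w : Fin k → ℝ)
    (σ : ℝ) : ℂ :=
  ∑' n : ℤ, gTerm A lam p x β w σ n

end

/-! ## Box dimension of graphs -/

/-! Write `w = v i`, `b = B i`. Completing the increment `φ(y + s w) - φ(y)` to a sum over all `n :
ℤ` gives `cocycle s y`. For fixed `s` it converges uniformly in `y`: `λ < 1` controls `n ≥ 0`, and
`|b| < λ` controls `n < 0`, where `A^{-n}` contracts `w`. The added half `negPart` is C¹ in `s` and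
`O(|s|)` uniformly in `y` (`contDiff_negPart`, `exists_negPart_le`). All roughness therefore sits in
`cocycle`, which is exactly self-similar: passing from `s` to `b^m s` multiplies it by `λ^m` and
moves the base point by `A^{-m}` (`cocycle_zpow_mul`).

The mean of `cocycle s` at frequency `σ ≠ 0` along a line is `g_σ (e^{iσs} - 1)`
(`torusMean_cocycle`). By uniqueness of coefficients along a line, the cocycle vanishes at `x` for
all `s` iff every `g_σ` with `σ ≠ 0` is zero (`cocycle_eq_zero_iff`). In that case the slice is a
constant minus `negPart`.

Otherwise self-similarity gives the Hölder exponent `α = ln λ / ln |b|`, hence the upper bound `2 -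
α`. For the lower bound, all points `A^{-n}(x + t w)` lie in a compact set at each point of which
the cocycle is nonzero for some `s` (`exists_cocycle_ne_zero`). Compactness makes this uniform, and
scaling turns it into oscillation at least `c r^α` near every point at every small scale `r`.
`area_le_of_cover` converts oscillation into a covering count. -/

theorem coveringNum_le {M : Type*} [PseudoMetricSpace M] {X : Set M} {δ : ℝ} {ι : Type*} [Fintype ι]
    (U : ι → Set M) (hU : ∀ j, Metric.ediam (U j) ≤ ENNReal.ofReal δ) (hX : X ⊆ ⋃ j, U j) :
    coveringNum X δ ≤ Fintype.card ι := by
  refine Nat.sInf_le ⟨U ∘ (Fintype.equivFin ι).symm, fun j => hU _, hX.trans ?_⟩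
  intro y hy
  obtain ⟨j, hj⟩ := Set.mem_iUnion.1 hy
  exact Set.mem_iUnion.2 ⟨Fintype.equivFin ι j, by simpa using hj⟩

/-- In `ℕ` the infimum of the empty set is `0`, so the minimum is known to be attained only once
some finite cover is at hand. -/
theorem exists_cover_coveringNum {M : Type*} [PseudoMetricSpace M] {X : Set M} {δ : ℝ}
    {ι : Type*} [Fintype ι]
    (U : ι → Set M) (hU : ∀ j, Metric.ediam (U j) ≤ ENNReal.ofReal δ) (hX : X ⊆ ⋃ j, U j) :
    ∃ V : Fin (coveringNum X δ) → Set M,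
      (∀ j, Metric.ediam (V j) ≤ ENNReal.ofReal δ) ∧ X ⊆ ⋃ j, V j := by
  refine Nat.sInf_mem (s := {n : ℕ | ∃ U : Fin n → Set M,
    (∀ j, Metric.ediam (U j) ≤ ENNReal.ofReal δ) ∧ X ⊆ ⋃ j, U j}) ?_
  refine ⟨_, U ∘ (Fintype.equivFin ι).symm, fun j => hU _, hX.trans ?_⟩
  intro y hy
  obtain ⟨j, hj⟩ := Set.mem_iUnion.1 hy
  exact Set.mem_iUnion.2 ⟨Fintype.equivFin ι j, by simpa using hj⟩

/-- Multiplicative constants disappear after dividing logarithms by `-log δ`, which tends to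
infinity. -/
theorem hasBoxDim_of_bounds {M : Type*} [PseudoMetricSpace M] {X : Set M} {d c C : ℝ}
    (hc : 0 < c) (hC : 0 < C)
    (hlow : ∀ᶠ δ : ℝ in 𝓝[>] 0, c * δ ^ (-d) ≤ coveringNum X δ)
    (hup : ∀ᶠ δ : ℝ in 𝓝[>] 0, coveringNum X δ ≤ C * δ ^ (-d)) : HasBoxDim X d := by
  have hlog : Tendsto (fun δ : ℝ => -Real.log δ) (𝓝[>] 0) atTop :=
    tendsto_neg_atBot_atTop.comp Real.tendsto_log_nhdsGT_zero
  have aux : ∀ K : ℝ, Tendsto (fun δ : ℝ => Real.log K / (-Real.log δ) + d) (𝓝[>] 0) (𝓝 d) := by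
    intro K
    simpa using (hlog.const_div_atTop (Real.log K)).add_const d
  have key : ∀ K : ℝ, 0 < K → ∀ δ : ℝ, 0 < δ → δ < 1 →
      Real.log (K * δ ^ (-d)) / (-Real.log δ) = Real.log K / (-Real.log δ) + d := by
    intro K hK δ h0 h1
    have : Real.log δ ≠ 0 := (Real.log_neg h0 h1).ne
    rw [Real.log_mul hK.ne' (Real.rpow_pos_of_pos h0 _).ne', Real.log_rpow h0]
    field_simp
    ring
  have hlt : ∀ᶠ δ : ℝ in 𝓝[>] 0, 0 < δ ∧ δ < 1 := Ioo_mem_nhdsGT one_pos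
  have ht : Tendsto (fun δ : ℝ => Real.log (coveringNum X δ) / (-Real.log δ)) (𝓝[>] 0) (𝓝 d) := by
    refine tendsto_of_tendsto_of_tendsto_of_le_of_le' (aux c) (aux C) ?_ ?_
    · filter_upwards [hlow, hlt] with δ h1 ⟨h2, h3⟩
      rw [← key c hc δ h2 h3]
      have : Real.log δ < 0 := Real.log_neg h2 h3
      have := Real.rpow_pos_of_pos h2 (-d)
      gcongr
      linarith
    · filter_upwards [hlow, hup, hlt] with δ h0 h1 ⟨h2, h3⟩
      rw [← key C hC δ h2 h3]
      have : Real.log δ < 0 := Real.log_neg h2 h3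
      have := Real.rpow_pos_of_pos h2 (-d)
      -- The lower bound excludes the value `0`, where monotonicity of `Real.log` fails.
      have : (0 : ℝ) < coveringNum X δ := by
        have := mul_pos hc this
        linarith
      gcongr
      linarith
  have ht' := (continuous_coe_real_ereal.tendsto d).comp ht
  exact ⟨ht'.liminf_eq, ht'.limsup_eq⟩

/-- A grid cover of the graph of a Hölder function. -/
theorem exists_cover_graphOver {f : ℝ → ℝ} {a b α C δ : ℝ} (hα : 0 ≤ α) (hC : 0 ≤ C)
    (hf : ∀ s t : ℝ, |t - s| ≤ 1 → |f t - f s| ≤ C * |t - s| ^ α) (hδ : 0 < δ) (hδ1 : δ ≤ 1) :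
    ∃ U : Fin (⌊(b - a) / δ⌋₊ + 1) × Fin (⌊2 * C * δ ^ (α - 1)⌋₊ + 1) →
        Set (EuclideanSpace ℝ (Fin 2)),
      (∀ j, Metric.ediam (U j) ≤ ENNReal.ofReal (2 * δ)) ∧ graphOver f a b ⊆ ⋃ j, U j := by
  -- Squares of side `δ`: over each column the graph stays within `C δ^α` of its value at the left
  -- end, so a stack of height `2 C δ^α` suffices.
  refine ⟨fun j => {z | z 0 ∈ Set.Icc (a + j.1 * δ) (a + j.1 * δ + δ) ∧
    z 1 ∈ Set.Icc (f (a + j.1 * δ) - C * δ ^ α + j.2 * δ)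
      (f (a + j.1 * δ) - C * δ ^ α + j.2 * δ + δ)}, ?_, ?_⟩
  · intro j
    refine Metric.ediam_le fun z hz w hw => ?_
    rw [edist_dist]
    refine ENNReal.ofReal_le_ofReal ?_
    rw [EuclideanSpace.dist_eq, Fin.sum_univ_two, Real.dist_eq, Real.dist_eq]
    refine Real.sqrt_le_iff.2 ⟨by positivity, ?_⟩
    obtain ⟨⟨h1, h2⟩, h3, h4⟩ := hz
    obtain ⟨⟨h5, h6⟩, h7, h8⟩ := hw
    have e1 : |z 0 - w 0| ≤ δ := abs_le.2 ⟨by linarith, by linarith⟩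
    have e2 : |z 1 - w 1| ≤ δ := abs_le.2 ⟨by linarith, by linarith⟩
    have e3 := pow_le_pow_left₀ (abs_nonneg _) e1 2
    have e4 := pow_le_pow_left₀ (abs_nonneg _) e2 2
    nlinarith [sq_nonneg δ]
  · rintro _ ⟨t, ⟨ht1, ht2⟩, rfl⟩
    have hn : 0 ≤ (t - a) / δ := div_nonneg (by linarith) hδ.le
    set m := ⌊(t - a) / δ⌋₊ with hm
    have m1 : (m : ℝ) * δ ≤ t - a := (le_div_iff₀ hδ).1 (Nat.floor_le hn)
    have m2 : t - a < (m + 1 : ℝ) * δ := (div_lt_iff₀ hδ).1 (Nat.lt_floor_add_one _)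
    have hm3 : m < ⌊(b - a) / δ⌋₊ + 1 := by
      refine Nat.lt_succ_of_le (Nat.floor_le_floor ?_)
      gcongr
    set s := a + m * δ with hs
    have hts : |t - s| ≤ δ := abs_le.2 ⟨by linarith, by linarith⟩
    have hfb : |f t - f s| ≤ C * δ ^ α :=
      (hf s t (hts.trans hδ1)).trans (by gcongr)
    obtain ⟨hfb1, hfb2⟩ := abs_le.1 hfb
    have hn' : 0 ≤ (f t - (f s - C * δ ^ α)) / δ := div_nonneg (by linarith) hδ.le
    set l := ⌊(f t - (f s - C * δ ^ α)) / δ⌋₊ with hl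
    have l1 : (l : ℝ) * δ ≤ f t - (f s - C * δ ^ α) := (le_div_iff₀ hδ).1 (Nat.floor_le hn')
    have l2 : f t - (f s - C * δ ^ α) < (l + 1 : ℝ) * δ :=
      (div_lt_iff₀ hδ).1 (Nat.lt_floor_add_one _)
    have hl3 : l < ⌊2 * C * δ ^ (α - 1)⌋₊ + 1 := by
      refine Nat.lt_succ_of_le (Nat.floor_le_floor ?_)
      rw [Real.rpow_sub_one hδ.ne', mul_div_assoc', div_le_div_iff_of_pos_right hδ]
      linarith
    refine Set.mem_iUnion.2 ⟨(⟨m, hm3⟩, ⟨l, hl3⟩), ?_⟩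
    simp only [Set.mem_ofPred_eq, Set.mem_Icc]
    refine ⟨⟨?_, ?_⟩, ?_, ?_⟩ <;> simp <;> linarith

/-- About `δ^{-1}` columns of about `δ^{α-1}` squares each. The mesh is `δ / 2` because the grid
squares are only bounded in diameter by twice the mesh. An optimal cover is returned as well, since
the lower bounds start from one. -/
theorem exists_cover_graphOver_of_isHolder {f : ℝ → ℝ} {a b α C : ℝ} (hab : a < b) (hα : 0 ≤ α)
    (hα1 : α ≤ 1) (hC : 0 ≤ C) (hf : ∀ s t : ℝ, |t - s| ≤ 1 → |f t - f s| ≤ C * |t - s| ^ α) :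
    ∃ K : ℝ, 0 < K ∧ ∀ᶠ δ : ℝ in 𝓝[>] 0, (coveringNum (graphOver f a b) δ : ℝ) ≤ K * δ ^ (-(2 - α)) ∧
      ∃ V : Fin (coveringNum (graphOver f a b) δ) → Set (EuclideanSpace ℝ (Fin 2)),
        (∀ j, Metric.ediam (V j) ≤ ENNReal.ofReal δ) ∧ graphOver f a b ⊆ ⋃ j, V j := by
  refine ⟨((b - a) + 1) * (2 * C + 1) * (1 / 2) ^ (-(2 - α)), by
    have : 0 < b - a := by linarith
    positivity, ?_⟩
  filter_upwards [Ioo_mem_nhdsGT (one_pos : (0:ℝ) < 1)] with δ ⟨h0, h1⟩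
  set ε := (1 / 2) * δ with hε
  have hε0 : 0 < ε := by positivity
  have hε1 : ε ≤ 1 := by linarith
  obtain ⟨U, hU, hUc⟩ := exists_cover_graphOver hα hC hf hε0 hε1
  have : 2 * ε = δ := by rw [hε]; ring
  rw [this] at hU
  refine ⟨?_, exists_cover_coveringNum U hU hUc⟩
  have h2 := coveringNum_le U hU hUc
  rw [Fintype.card_prod, Fintype.card_fin, Fintype.card_fin] at h2
  have h3 : (coveringNum (graphOver f a b) δ : ℝ) ≤
      (⌊(b - a) / ε⌋₊ + 1) * (⌊2 * C * ε ^ (α - 1)⌋₊ + 1) := by exact_mod_cast h2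
  refine h3.trans ?_
  have hba : 0 < b - a := by linarith
  have e1 : (⌊(b - a) / ε⌋₊ : ℝ) + 1 ≤ ((b - a) + 1) * ε⁻¹ := by
    have := Nat.floor_le (div_nonneg hba.le hε0.le)
    have h4 : 1 ≤ ε⁻¹ := (one_le_inv₀ hε0).2 hε1
    rw [div_eq_mul_inv] at this
    rw [add_mul, one_mul, div_eq_mul_inv]
    linarith
  have e2 : (⌊2 * C * ε ^ (α - 1)⌋₊ : ℝ) + 1 ≤ (2 * C + 1) * ε ^ (α - 1) := by
    have h5 : 0 ≤ ε ^ (α - 1) := by positivity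
    have := Nat.floor_le (mul_nonneg (mul_nonneg zero_le_two hC) h5)
    have h4 : 1 ≤ ε ^ (α - 1) := Real.one_le_rpow_of_pos_of_le_one_of_nonpos hε0 hε1 (by linarith)
    rw [add_mul (2 * C), one_mul]
    linarith
  calc _ ≤ ((b - a) + 1) * ε⁻¹ * ((2 * C + 1) * ε ^ (α - 1)) := by gcongr
    _ = ((b - a) + 1) * (2 * C + 1) * ε ^ (-(2 - α)) := by
      rw [show -(2 - α) = (-1 : ℝ) + (α - 1) by ring, Real.rpow_add hε0, Real.rpow_neg_one]
      ring
    _ = _ := by rw [hε, Real.mul_rpow (by norm_num) h0.le]; ring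

/-- The points of a cover of the graph are caught by finitely many squares. -/
theorem exists_centers_of_cover {f : ℝ → ℝ} {a b δ : ℝ} (hδ : 0 < δ) {n : ℕ}
    {V : Fin n → Set (EuclideanSpace ℝ (Fin 2))}
    (hV : ∀ j, Metric.ediam (V j) ≤ ENNReal.ofReal δ) (hc : graphOver f a b ⊆ ⋃ j, V j) :
    ∃ z : Fin n → ℝ × ℝ, ∀ t ∈ Set.Icc a b, ∃ j, |t - (z j).1| ≤ δ ∧ |f t - (z j).2| ≤ δ := by
  classical
  refine ⟨fun j => if h : (V j).Nonempty then (h.some 0, h.some 1) else 0, fun t ht => ?_⟩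
  obtain ⟨j, hj⟩ := Set.mem_iUnion.1 (hc ⟨t, ht, rfl⟩)
  have hne : (V j).Nonempty := ⟨_, hj⟩
  refine ⟨j, ?_⟩
  simp only [dif_pos hne]
  have h1 : dist !₂[t, f t] hne.some ≤ δ := by
    have := (Metric.edist_le_ediam_of_mem hj hne.some_mem).trans (hV j)
    rw [edist_dist] at this
    exact (ENNReal.ofReal_le_ofReal_iff hδ.le).1 this
  rw [EuclideanSpace.dist_eq, Fin.sum_univ_two, Real.dist_eq, Real.dist_eq,
    Real.sqrt_le_left hδ.le] at h1
  simp only [sq_abs] at h1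
  constructor
  · refine abs_le_of_sq_le_sq (le_trans ?_ h1) hδ.le
    have := sq_nonneg (f t - hne.some 1)
    simp at this ⊢
    linarith
  · refine abs_le_of_sq_le_sq (le_trans ?_ h1) hδ.le
    have := sq_nonneg (t - hne.some 0)
    simp at this ⊢
    linarith

open MeasureTheory in
-- Projection to the first axis covers `[a, b]` by `n` intervals of length `2δ`.
theorem length_le_of_cover {f : ℝ → ℝ} {a b δ : ℝ} (hδ : 0 < δ) {n : ℕ}
    {V : Fin n → Set (EuclideanSpace ℝ (Fin 2))}
    (hV : ∀ j, Metric.ediam (V j) ≤ ENNReal.ofReal δ) (hc : graphOver f a b ⊆ ⋃ j, V j) :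
    b - a ≤ n * (2 * δ) := by
  obtain ⟨z, hz⟩ := exists_centers_of_cover hδ hV hc
  have h1 : Set.Icc a b ⊆ ⋃ j, Metric.closedBall (z j).1 δ := by
    intro t ht
    obtain ⟨j, hj, -⟩ := hz t ht
    exact Set.mem_iUnion.2 ⟨j, by rwa [Metric.mem_closedBall, Real.dist_eq]⟩
  have h2 := (measure_mono (μ := volume) h1).trans (measure_iUnion_fintype_le _ _)
  simp only [Real.volume_Icc, Real.volume_closedBall, Finset.sum_const, Finset.card_univ,
    Fintype.card_fin, nsmul_eq_mul] at h2
  rw [← ENNReal.ofReal_natCast, ← ENNReal.ofReal_mul (by positivity)] at h2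
  exact (ENNReal.ofReal_le_ofReal_iff (by positivity)).1 h2

open MeasureTheory Classical in
-- By the intermediate value theorem the graph within `δ` of `s` sweeps a vertical interval of
-- length at least `η`. It is covered by the vertical shadows (length `2δ`) of the pieces centred
-- within `2δ` of `s`. Integrating over `s`, each piece contributes at most `4δ · 2δ`.
theorem area_le_of_cover {f : ℝ → ℝ} (hf : Continuous f) {a b δ η : ℝ} (hδ : 0 < δ) (hη : 0 ≤ η)
    (hosc : ∀ s : ℝ, ∃ t, |t - s| ≤ δ ∧ η ≤ |f t - f s|) {n : ℕ}
    {V : Fin n → Set (EuclideanSpace ℝ (Fin 2))}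
    (hV : ∀ j, Metric.ediam (V j) ≤ ENNReal.ofReal δ) (hc : graphOver f a b ⊆ ⋃ j, V j) :
    (b - a - 2 * δ) * η ≤ n * (8 * δ ^ 2) := by
  obtain ⟨z, hz⟩ := exists_centers_of_cover hδ hV hc
  have key : ∀ s ∈ Set.Icc (a + δ) (b - δ), ENNReal.ofReal η ≤
      ∑ j, (Metric.closedBall (z j).1 (2 * δ)).indicator (fun _ => ENNReal.ofReal (2 * δ)) s := by
    intro s hs
    obtain ⟨t, ht, hη⟩ := hosc s
    obtain ⟨ht1, ht2⟩ := abs_le.1 ht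
    have hsub : Set.uIcc (f s) (f t) ⊆ ⋃ j, if s ∈ Metric.closedBall (z j).1 (2 * δ) then
        Metric.closedBall (z j).2 δ else ∅ := by
      intro y hy
      obtain ⟨u, hu, rfl⟩ := intermediate_value_uIcc (hf.continuousOn) hy
      have hus : |u - s| ≤ δ := (Set.abs_sub_left_of_mem_uIcc hu).trans ht
      obtain ⟨hu1, hu2⟩ := abs_le.1 hus
      obtain ⟨j, hj1, hj2⟩ := hz u ⟨by linarith [hs.1], by linarith [hs.2]⟩
      refine Set.mem_iUnion.2 ⟨j, ?_⟩
      rw [if_pos]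
      · rwa [Metric.mem_closedBall, Real.dist_eq]
      · rw [Metric.mem_closedBall, Real.dist_eq]
        have := abs_le.1 hj1
        exact abs_le.2 ⟨by linarith, by linarith⟩
    have h2 := (measure_mono (μ := volume) hsub).trans (measure_iUnion_fintype_le _ _)
    rw [Real.volume_interval] at h2
    refine (ENNReal.ofReal_le_ofReal hη).trans (h2.trans (Finset.sum_le_sum fun j _ => ?_))
    by_cases h : s ∈ Metric.closedBall (z j).1 (2 * δ)
    · rw [if_pos h, Set.indicator_of_mem h, Real.volume_closedBall]
    · rw [if_neg h]; simp
  have h3 : ∫⁻ s in Set.Icc (a + δ) (b - δ), ENNReal.ofReal η ≤ ∫⁻ s, ∑ j,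
      (Metric.closedBall (z j).1 (2 * δ)).indicator (fun _ => ENNReal.ofReal (2 * δ)) s :=
    (setLIntegral_mono' measurableSet_Icc key).trans (setLIntegral_le_lintegral _ _)
  rw [lintegral_finsetSum _ fun j _ =>
    measurable_const.indicator Metric.isClosed_closedBall.measurableSet] at h3
  simp only [lintegral_const, lintegral_indicator_const Metric.isClosed_closedBall.measurableSet,
    Measure.restrict_apply MeasurableSet.univ, Set.univ_inter, Real.volume_Icc,
    Real.volume_closedBall, Finset.sum_const, Finset.card_univ,
    Fintype.card_fin, nsmul_eq_mul] at h3
  rw [← ENNReal.ofReal_natCast, ← ENNReal.ofReal_mul hη, ← ENNReal.ofReal_mul (by positivity),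
    ← ENNReal.ofReal_mul (by positivity), ENNReal.ofReal_le_ofReal_iff (by positivity)] at h3
  calc _ = η * (b - δ - (a + δ)) := by ring
    _ ≤ _ := h3
    _ = _ := by ring

theorem hasBoxDim_graphOver_one {f : ℝ → ℝ} {a b C : ℝ} (hab : a < b) (hC : 0 ≤ C)
    (hf : ∀ s t : ℝ, |t - s| ≤ 1 → |f t - f s| ≤ C * |t - s|) : HasBoxDim (graphOver f a b) 1 := by
  obtain ⟨K, hK, h⟩ := exists_cover_graphOver_of_isHolder (f := f) hab zero_le_one le_rfl hC
    (by simpa using hf)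
  have hba : 0 < b - a := by linarith
  refine hasBoxDim_of_bounds (c := (b - a) / 2) (by positivity) hK ?_
    (h.mono fun δ hδ => by simpa [show -(2 - 1 : ℝ) = -1 by norm_num] using hδ.1)
  filter_upwards [h, self_mem_nhdsWithin] with δ ⟨_, V, hV, hc⟩ hδ
  have h0 : 0 < δ := hδ
  have := length_le_of_cover h0 hV hc
  rw [Real.rpow_neg_one, ← div_eq_mul_inv, div_div, div_le_iff₀ (by positivity)]
  exact this

theorem hasBoxDim_graphOver_of_holder_of_osc {f : ℝ → ℝ} (hfc : Continuous f) {a b α c C : ℝ}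
    (hab : a < b) (hα : 0 ≤ α) (hα1 : α ≤ 1) (hc : 0 < c) (hC : 0 ≤ C)
    (hf : ∀ s t : ℝ, |t - s| ≤ 1 → |f t - f s| ≤ C * |t - s| ^ α)
    (hosc : ∀ᶠ r : ℝ in 𝓝[>] 0, ∀ s : ℝ, ∃ t, |t - s| ≤ r ∧ c * r ^ α ≤ |f t - f s|) :
    HasBoxDim (graphOver f a b) (2 - α) := by
  obtain ⟨K, hK, h⟩ := exists_cover_graphOver_of_isHolder (f := f) hab hα hα1 hC hf
  have hba : 0 < b - a := by linarith
  refine hasBoxDim_of_bounds (c := (b - a) / 2 * c / 8) (by positivity) hK ?_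
    (h.mono fun δ hδ => hδ.1)
  -- With `δ < (b - a) / 4`, trimming `δ` at both ends leaves at least half of the interval.
  filter_upwards [h, hosc, Ioo_mem_nhdsGT (show 0 < (b - a) / 4 by positivity)] with
    δ ⟨_, V, hV, hcov⟩ hosc ⟨h0, h1⟩
  have hp : 0 < δ ^ α := Real.rpow_pos_of_pos h0 _
  have h2 := area_le_of_cover hfc h0 (by positivity) hosc hV hcov
  have h3 : (b - a) / 2 * (c * δ ^ α) ≤ (b - a - 2 * δ) * (c * δ ^ α) := by
    gcongr
    linarith
  rw [neg_sub, Real.rpow_sub h0, Real.rpow_two, mul_div_assoc', div_le_iff₀ (by positivity)]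
  linarith

noncomputable section

/-! ## Means along lines of the torus -/

/-- The means `(1 / 2T) ∫_{-T}^{T} f(t) e^{-iat} dt` of a complex-valued function. -/
def lineMean (f : ℝ → ℂ) (a : ℝ) (T : ℝ) : ℂ :=
  (1 / (2 * T) : ℂ) * ∫ t in (-T)..T, f t * Complex.exp (-(Complex.I * a * t))

theorem lineMean_add {f g : ℝ → ℂ} (hf : Continuous f) (hg : Continuous g) (a T : ℝ) :
    lineMean (fun t => f t + g t) a T = lineMean f a T + lineMean g a T := by
  simp only [lineMean, add_mul]
  rw [intervalIntegral.integral_add, mul_add]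
  · exact Continuous.intervalIntegrable (by fun_prop) _ _
  · exact Continuous.intervalIntegrable (by fun_prop) _ _

theorem lineMean_const_mul (c : ℂ) (f : ℝ → ℂ) (a T : ℝ) :
    lineMean (fun t => c * f t) a T = c * lineMean f a T := by
  simp only [lineMean, mul_assoc]
  rw [intervalIntegral.integral_const_mul]
  ring

theorem norm_lineMean_le {f : ℝ → ℂ} {C : ℝ} (hf : ∀ t, ‖f t‖ ≤ C) (a : ℝ) {T : ℝ} (hT : 0 < T) :
    ‖lineMean f a T‖ ≤ C := by
  have h := intervalIntegral.norm_integral_le_of_norm_le_const (a := -T) (b := T) (C := C)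
    (f := fun t : ℝ => f t * Complex.exp (-(Complex.I * a * t))) fun t _ => by
      rw [norm_mul, show -(Complex.I * a * t) = ((-(a * t) : ℝ) : ℂ) * Complex.I by push_cast; ring,
        Complex.norm_exp_ofReal_mul_I, mul_one]
      exact hf t
  rw [lineMean, norm_mul]
  have h1 : ‖(1 / (2 * T) : ℂ)‖ = 1 / (2 * T) := by
    rw [norm_div, norm_mul]; simp [abs_of_pos hT]
  rw [h1, div_mul_eq_mul_div, one_mul, div_le_iff₀ (by positivity)]
  refine h.trans_eq ?_
  rw [sub_neg_eq_add, abs_of_pos (by positivity)]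
  ring

theorem tendsto_lineMean_exp (a b : ℝ) :
    Tendsto (lineMean (fun t => Complex.exp (Complex.I * b * t)) a) atTop
      (𝓝 (if b = a then 1 else 0)) := by
  have e : ∀ t : ℝ, Complex.exp (Complex.I * b * t) * Complex.exp (-(Complex.I * a * t)) =
      Complex.exp ((Complex.I * (b - a)) * t) := fun t => by
    rw [← Complex.exp_add]; ring_nf
  split_ifs with h
  · refine tendsto_const_nhds.congr' ?_
    filter_upwards [eventually_gt_atTop 0] with T hT
    have : (T : ℂ) ≠ 0 := by exact_mod_cast hT.ne'
    subst h
    simp only [lineMean, e, sub_self, mul_zero, zero_mul, Complex.exp_zero,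
      intervalIntegral.integral_const, sub_neg_eq_add, Complex.real_smul]
    push_cast
    field_simp
    norm_num
  · have hc : Complex.I * ((b : ℂ) - a) ≠ 0 :=
      mul_ne_zero Complex.I_ne_zero (by exact_mod_cast sub_ne_zero.2 h)
    have hn : ∀ t : ℝ, ‖Complex.exp ((Complex.I * (b - a)) * t)‖ = 1 := fun t => by
      rw [show Complex.I * ((b : ℂ) - a) * t = (((b - a) * t : ℝ) : ℂ) * Complex.I by
        push_cast; ring, Complex.norm_exp_ofReal_mul_I]
    have hlim : Tendsto (fun T : ℝ => (2 / ‖Complex.I * ((b : ℂ) - a)‖) / (2 * T)) atTop (𝓝 0) :=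
      Tendsto.const_div_atTop (tendsto_id.const_mul_atTop two_pos) _
    refine squeeze_zero_norm' ?_ hlim
    filter_upwards [eventually_gt_atTop 0] with T hT
    simp only [lineMean, e]
    have h1 : ‖(1 / (2 * T) : ℂ)‖ = 1 / (2 * T) := by
      rw [norm_div, norm_mul]; simp [abs_of_pos hT]
    rw [integral_exp_mul_complex hc, norm_mul, h1, norm_div, one_div, mul_comm, ← div_eq_mul_inv]
    gcongr
    refine (norm_sub_le _ _).trans ?_
    rw [hn, hn]; norm_num

variable {k : ℕ}

theorem torusProj_add (y z : Fin k → ℝ) : torusProj (y + z) = torusProj y + torusProj z := by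
  ext l; simp [torusProj]

theorem torusProj_zero : torusProj (0 : Fin k → ℝ) = 0 := by
  ext l; simp [torusProj]

theorem torusProj_neg (y : Fin k → ℝ) : torusProj (-y) = -torusProj y := by
  ext l; simp [torusProj]

theorem continuous_torusProj : Continuous (torusProj : (Fin k → ℝ) → UnitAddTorus (Fin k)) :=
  continuous_pi fun l => (AddCircle.continuous_mk' 1).comp (continuous_apply l)

/-- The line `t ↦ t w` on the torus. -/
def torusLine (w : Fin k → ℝ) (t : ℝ) : UnitAddTorus (Fin k) := torusProj (t • w)

theorem torusLine_add (w : Fin k → ℝ) (s t : ℝ) :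
    torusLine w (s + t) = torusLine w s + torusLine w t := by
  rw [torusLine, add_smul, torusProj_add]; rfl

theorem torusLine_zero (w : Fin k → ℝ) : torusLine w 0 = 0 := by
  rw [torusLine, zero_smul, torusProj_zero]

theorem torusLine_neg (w : Fin k → ℝ) (t : ℝ) : torusLine w (-t) = -torusLine w t := by
  rw [torusLine, neg_smul, torusProj_neg]; rfl

theorem torusLine_smul (w : Fin k → ℝ) (c t : ℝ) : torusLine (c • w) t = torusLine w (t * c) := by
  rw [torusLine, smul_smul]; rfl

@[fun_prop]
theorem continuous_torusLine (w : Fin k → ℝ) : Continuous (torusLine w) :=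
  continuous_torusProj.comp (by fun_prop)

/-- The frequency of the character `m` along the direction `w`. -/
def lineFreq (m : Fin k → ℤ) (w : Fin k → ℝ) : ℝ := 2 * Real.pi * ∑ l, m l * w l

open UnitAddTorus

theorem mFourier_add_apply (m : Fin k → ℤ) (y z : UnitAddTorus (Fin k)) :
    mFourier m (y + z) = mFourier m y * mFourier m z := by
  simp [mFourier, fourier_apply, Finset.prod_mul_distrib, AddCircle.toCircle_add]

theorem mFourier_torusLine (m : Fin k → ℤ) (w : Fin k → ℝ) (t : ℝ) :
    mFourier m (torusLine w t) = Complex.exp (Complex.I * lineFreq m w * t) := by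
  simp only [mFourier, torusLine, torusProj, ContinuousMap.coe_mk, fourier_coe_apply]
  rw [← Complex.exp_sum]
  congr 1
  rw [lineFreq]
  push_cast
  rw [Finset.mul_sum, Finset.mul_sum, Finset.sum_mul]
  refine Finset.sum_congr rfl fun l _ => ?_
  simp
  ring

/-- Trigonometric polynomials are dense, so a closed property stable under linear combinations need
only be checked on characters. -/
theorem torus_induction {P : C(UnitAddTorus (Fin k), ℂ) → Prop} (hcl : IsClosed ({f | P f}))
    (hm : ∀ m, P (mFourier m)) (hadd : ∀ f g, P f → P g → P (f + g))
    (hsmul : ∀ (c : ℂ) f, P f → P (c • f)) (f : C(UnitAddTorus (Fin k), ℂ)) : P f := by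
  have h1 : (Submodule.span ℂ (Set.range (mFourier (d := Fin k))) : Set _) ⊆ {f | P f} := by
    intro g hg
    refine Submodule.span_induction (p := fun g _ => P g) ?_ ?_ ?_ ?_ hg
    · rintro _ ⟨m, rfl⟩; exact hm m
    · have e : (0 : ℂ) • mFourier (0 : Fin k → ℤ) = 0 := by ext; simp
      exact e ▸ hsmul 0 _ (hm 0)
    · exact fun f g _ _ => hadd f g
    · exact fun c f _ => hsmul c f
  have h2 : f ∈ (Submodule.span ℂ (Set.range (mFourier (d := Fin k)))).topologicalClosure := by
    rw [span_mFourier_closure_eq_top]; trivial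
  exact closure_minimal h1 hcl h2

theorem torus_clm_ext {f g : C(UnitAddTorus (Fin k), ℂ) →L[ℂ] ℂ}
    (h : ∀ m, f (mFourier m) = g (mFourier m)) : f = g := by
  ext F
  refine torus_induction (P := fun F => f F = g F) (isClosed_eq f.continuous g.continuous) h ?_ ?_ F
  · intro F G hF hG; rw [map_add, map_add, hF, hG]
  · intro c F hF; rw [map_smul, map_smul, hF]

theorem tendsto_lineMean_mFourier (m : Fin k → ℤ) (y : UnitAddTorus (Fin k)) (w : Fin k → ℝ)
    (a : ℝ) :
    Tendsto (lineMean (fun t => mFourier m (y + torusLine w t)) a) atTop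
      (𝓝 (mFourier m y * if lineFreq m w = a then 1 else 0)) := by
  refine ((tendsto_lineMean_exp a (lineFreq m w)).const_mul (mFourier m y)).congr fun T => ?_
  rw [← lineMean_const_mul]
  simp only [mFourier_add_apply, mFourier_torusLine]

/-- Explicit for characters. The set of good `f` is closed because the means are bounded by the sup
norm uniformly in `T`, so an `ε/3` argument gives the Cauchy property. -/
theorem exists_tendsto_lineMean (f : C(UnitAddTorus (Fin k), ℂ)) (y : UnitAddTorus (Fin k))
    (w : Fin k → ℝ) (a : ℝ) :
    ∃ c, Tendsto (lineMean (fun t => f (y + torusLine w t)) a) atTop (𝓝 c) := by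
  refine torus_induction
    (P := fun f => ∃ c, Tendsto (lineMean (fun t => f (y + torusLine w t)) a) atTop (𝓝 c))
    ?_ (fun m => ⟨_, tendsto_lineMean_mFourier m y w a⟩) ?_ ?_ f
  · rw [← closure_subset_iff_isClosed]
    intro f hf
    refine cauchySeq_tendsto_of_complete (Metric.cauchySeq_iff.2 fun ε hε => ?_)
    obtain ⟨g, ⟨c, hc⟩, hg⟩ := Metric.mem_closure_iff.1 hf (ε / 3) (by positivity)
    obtain ⟨N, hN⟩ := Metric.cauchySeq_iff.1 hc.cauchySeq (ε / 3) (by positivity)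
    have key : ∀ T : ℝ, 0 < T → dist (lineMean (fun t => f (y + torusLine w t)) a T)
        (lineMean (fun t => g (y + torusLine w t)) a T) ≤ dist f g := by
      intro T hT
      have h := norm_lineMean_le (f := fun t => (f - g) (y + torusLine w t)) (C := dist f g)
        (fun t => by rw [dist_eq_norm]; exact (f - g).norm_coe_le_norm _) a hT
      have h2 := lineMean_add (f := fun t => (f - g) (y + torusLine w t))
        (g := fun t => g (y + torusLine w t)) (by fun_prop) (by fun_prop) a T
      simp only [ContinuousMap.sub_apply, sub_add_cancel] at h2 h
      rw [h2, dist_eq_norm, add_sub_cancel_right]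
      exact h
    refine ⟨max N 1, fun T hT S hS => ?_⟩
    have hT0 : 0 < T := one_pos.trans_le ((le_max_right _ _).trans hT)
    have hS0 : 0 < S := one_pos.trans_le ((le_max_right _ _).trans hS)
    have h1 := key T hT0
    have h2 := key S hS0
    have h3 := hN T ((le_max_left _ _).trans hT) S ((le_max_left _ _).trans hS)
    have h4 := dist_triangle4_right (lineMean (fun t => f (y + torusLine w t)) a T)
      (lineMean (fun t => f (y + torusLine w t)) a S)
      (lineMean (fun t => g (y + torusLine w t)) a T)
      (lineMean (fun t => g (y + torusLine w t)) a S)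
    linarith
  · rintro f g ⟨c, hc⟩ ⟨d, hd⟩
    exact ⟨c + d, (hc.add hd).congr fun T => (lineMean_add (by fun_prop) (by fun_prop) a T).symm⟩
  · rintro c f ⟨d, hd⟩
    exact ⟨c * d, (hd.const_mul c).congr fun T => (lineMean_const_mul c _ a T).symm⟩

/-- The mean at frequency `a` along the line through `y` in direction `w`, as a functional. -/
def torusMean (y : UnitAddTorus (Fin k)) (w : Fin k → ℝ) (a : ℝ) :
    C(UnitAddTorus (Fin k), ℂ) →L[ℂ] ℂ :=
  LinearMap.mkContinuous
    { toFun := fun f => limUnder atTop (lineMean (fun t => f (y + torusLine w t)) a)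
      map_add' := fun f g => by
        have hf := tendsto_nhds_limUnder (exists_tendsto_lineMean f y w a)
        have hg := tendsto_nhds_limUnder (exists_tendsto_lineMean g y w a)
        exact ((hf.add hg).congr fun T =>
          (lineMean_add (by fun_prop) (by fun_prop) a T).symm).limUnder_eq
      map_smul' := fun c f => by
        have hf := tendsto_nhds_limUnder (exists_tendsto_lineMean f y w a)
        exact ((hf.const_mul c).congr fun T => (lineMean_const_mul c _ a T).symm).limUnder_eq }
    1 fun f => by
      have hf := tendsto_nhds_limUnder (exists_tendsto_lineMean f y w a)
      rw [one_mul]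
      refine le_of_tendsto hf.norm ?_
      filter_upwards [eventually_gt_atTop 0] with T hT
      exact norm_lineMean_le (fun t => f.norm_coe_le_norm _) a hT

theorem tendsto_torusMean (f : C(UnitAddTorus (Fin k), ℂ)) (y : UnitAddTorus (Fin k))
    (w : Fin k → ℝ) (a : ℝ) :
    Tendsto (lineMean (fun t => f (y + torusLine w t)) a) atTop (𝓝 (torusMean y w a f)) :=
  tendsto_nhds_limUnder (exists_tendsto_lineMean f y w a)

theorem torusMean_mFourier (m : Fin k → ℤ) (y : UnitAddTorus (Fin k)) (w : Fin k → ℝ)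
    (a : ℝ) : torusMean y w a (mFourier m) = mFourier m y * if lineFreq m w = a then 1 else 0 :=
  (tendsto_lineMean_mFourier m y w a).limUnder_eq

theorem torusMean_congr {f g : C(UnitAddTorus (Fin k), ℂ)} {y z : UnitAddTorus (Fin k)}
    {w u : Fin k → ℝ} (h : ∀ t, f (y + torusLine w t) = g (z + torusLine u t)) (a : ℝ) :
    torusMean y w a f = torusMean z u a g := by
  refine tendsto_nhds_unique (tendsto_torusMean f y w a) ?_
  simp only [h]
  exact tendsto_torusMean g z u a

theorem torusMean_smul_dir (y : UnitAddTorus (Fin k)) (w : Fin k → ℝ) (a : ℝ) {c : ℝ}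
    (hc : c ≠ 0) : torusMean y (c • w) (a * c) = torusMean y w a := by
  refine torus_clm_ext fun m => ?_
  rw [torusMean_mFourier, torusMean_mFourier]
  have : lineFreq m (c • w) = lineFreq m w * c := by
    simp only [lineFreq, Pi.smul_apply, smul_eq_mul, mul_assoc, Finset.sum_mul]
    simp only [mul_comm c]
  simp [this, hc]

/-- At frequency `0` only characters constant along the direction contribute, and the base point
enters only through their values. -/
theorem torusMean_eq_of_mFourier_eq {y z : UnitAddTorus (Fin k)} {w : Fin k → ℝ}
    (h : ∀ m, lineFreq m w = 0 → mFourier m y = mFourier m z) :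
    torusMean y w 0 = torusMean z w 0 := by
  refine torus_clm_ext fun m => ?_
  rw [torusMean_mFourier, torusMean_mFourier]
  split_ifs with hm
  · rw [h m hm]
  · simp

/-- The translate `f(· + z)`. -/
def torusShift (z : UnitAddTorus (Fin k)) (f : C(UnitAddTorus (Fin k), ℂ)) :
    C(UnitAddTorus (Fin k), ℂ) := f.comp ⟨fun y => y + z, by fun_prop⟩

theorem torusMean_shift (f : C(UnitAddTorus (Fin k), ℂ)) (y : UnitAddTorus (Fin k))
    (w : Fin k → ℝ) (a s : ℝ) :
    torusMean y w a (torusShift (torusLine w s) f) =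
      Complex.exp (Complex.I * a * s) * torusMean y w a f := by
  refine torus_induction (P := fun f => torusMean y w a (torusShift (torusLine w s) f) =
    Complex.exp (Complex.I * a * s) * torusMean y w a f) ?_ ?_ ?_ ?_ f
  · refine isClosed_eq ((torusMean y w a).continuous.comp ?_) (by fun_prop)
    exact ContinuousMap.continuous_precomp _
  · intro m
    have : torusShift (torusLine w s) (mFourier m) =
        Complex.exp (Complex.I * lineFreq m w * s) • mFourier m := by
      ext z
      change mFourier m (z + torusLine w s) = _ * mFourier m z
      rw [mFourier_add_apply, mFourier_torusLine, mul_comm]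
    rw [this, map_smul, torusMean_mFourier, smul_eq_mul]
    split_ifs with h
    · rw [h]
    · simp
  · intro f g hf hg
    have : torusShift (torusLine w s) (f + g) =
      torusShift (torusLine w s) f + torusShift (torusLine w s) g := rfl
    rw [this, map_add, map_add, hf, hg, mul_add]
  · intro c f hf
    have : torusShift (torusLine w s) (c • f) = c • torusShift (torusLine w s) f := rfl
    rw [this, map_smul, map_smul, hf, smul_eq_mul, smul_eq_mul]
    ring

theorem torusMean_mFourier_mul (m : Fin k → ℤ) (f : C(UnitAddTorus (Fin k), ℂ))
    (y : UnitAddTorus (Fin k)) (w : Fin k → ℝ) (a : ℝ) :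
    torusMean y w a (mFourier m * f) = mFourier m y * torusMean y w (a - lineFreq m w) f := by
  refine tendsto_nhds_unique (tendsto_torusMean _ y w a) ?_
  refine ((tendsto_torusMean f y w (a - lineFreq m w)).const_mul (mFourier m y)).congr fun T => ?_
  rw [← lineMean_const_mul]
  simp only [lineMean, ContinuousMap.mul_apply, mFourier_add_apply, mFourier_torusLine]
  congr 2
  funext t
  rw [show -(Complex.I * ((a - lineFreq m w : ℝ) : ℂ) * t) =
    Complex.I * lineFreq m w * t + -(Complex.I * a * t) by push_cast; ring, Complex.exp_add]
  ring

theorem le_re_torusMean {f : C(UnitAddTorus (Fin k), ℂ)} {g : ℝ → ℝ} {c : ℝ}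
    {y : UnitAddTorus (Fin k)} {w : Fin k → ℝ} (hg : Continuous g)
    (hfg : ∀ t, f (y + torusLine w t) = g t) (hc : ∀ t, c ≤ g t) :
    c ≤ (torusMean y w 0 f).re := by
  have h := (Complex.continuous_re.tendsto _).comp (tendsto_torusMean f y w 0)
  refine ge_of_tendsto h ?_
  filter_upwards [eventually_gt_atTop 0] with T hT
  have : lineMean (fun t => f (y + torusLine w t)) 0 T =
      (((1 / (2 * T)) * ∫ t in (-T)..T, g t : ℝ) : ℂ) := by
    have h0 : ∀ t : ℝ, -(Complex.I * ((0 : ℝ) : ℂ) * t) = 0 := fun t => by simp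
    simp only [lineMean, hfg, h0, Complex.exp_zero, mul_one, intervalIntegral.integral_ofReal]
    push_cast
    rfl
  rw [Function.comp_apply, this, Complex.ofReal_re, div_mul_eq_mul_div, one_mul,
    le_div_iff₀ (by positivity)]
  have h1 := intervalIntegral.integral_mono_on (a := -T) (b := T) (by linarith)
    (f := fun _ => c) (g := g) (μ := MeasureTheory.volume) (by simp)
    (hg.intervalIntegrable _ _) (fun t _ => hc t)
  rw [intervalIntegral.integral_const, smul_eq_mul] at h1
  linarith

/-- A continuous function with vanishing quadratic mean along a line vanishes on it. -/
theorem eq_zero_of_torusMean_star_mul_self {f : C(UnitAddTorus (Fin k), ℂ)}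
    {y : UnitAddTorus (Fin k)} {w : Fin k → ℝ} (h : torusMean y w 0 (star f * f) = 0) :
    f y = 0 := by
  by_contra hne
  have hc : 0 < ‖f y‖ ^ 2 / 2 := by positivity
  set c := ‖f y‖ ^ 2 / 2 with hcdef
  have hopen : IsOpen {z | c < ‖f (y + z)‖ ^ 2} := isOpen_lt (by fun_prop) (by fun_prop)
  have h0 : (0 : UnitAddTorus (Fin k)) ∈ {z | c < ‖f (y + z)‖ ^ 2} := by
    change c < ‖f (y + 0)‖ ^ 2
    rw [add_zero]
    linarith
  have hK : IsCompact (closure (Set.range (torusLine w))) := isClosed_closure.isCompact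
  -- Almost periodicity by compactness: finitely many translates along the line of the region `|f|²
  -- > c` cover the whole line. The sum of the corresponding translates of `|f|²` is then at least
  -- `c` on the line, while its mean is zero.
  obtain ⟨J, hJ⟩ := hK.elim_finite_subcover
    (fun s : ℝ => {z | c < ‖f (y + (z - torusLine w s))‖ ^ 2})
    (fun s => isOpen_lt (by fun_prop) (by fun_prop)) (by
      intro z hz
      have hU : {u | c < ‖f (y + (z - u))‖ ^ 2} ∈ 𝓝 z :=
        (isOpen_lt (f := fun _ => c) (g := fun u => ‖f (y + (z - u))‖ ^ 2) (by fun_prop)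
          (by fun_prop)).mem_nhds (by simpa using h0)
      obtain ⟨u, hu, s, rfl⟩ := mem_closure_iff_nhds.1 hz _ hU
      exact Set.mem_iUnion.2 ⟨s, hu⟩)
  have hsum : torusMean y w 0 (∑ s ∈ J, torusShift (torusLine w (-s)) (star f * f)) = 0 := by
    rw [map_sum]
    refine Finset.sum_eq_zero fun s _ => ?_
    rw [torusMean_shift, h, mul_zero]
  have hle := le_re_torusMean (c := c) (y := y) (w := w)
    (f := ∑ s ∈ J, torusShift (torusLine w (-s)) (star f * f))
    (g := fun t => ∑ s ∈ J, ‖f (y + torusLine w t + torusLine w (-s))‖ ^ 2) (by fun_prop) (by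
      intro t
      rw [ContinuousMap.sum_apply]
      push_cast
      refine Finset.sum_congr rfl fun s _ => ?_
      exact Complex.conj_mul' _) (by
      intro t
      obtain ⟨s, hs⟩ := Set.mem_iUnion.1 (hJ (subset_closure ⟨t, rfl⟩))
      obtain ⟨hsJ, hs⟩ := Set.mem_iUnion.1 hs
      have h1 : c < ‖f (y + torusLine w t + torusLine w (-s))‖ ^ 2 := by
        rw [torusLine_neg, add_assoc, ← sub_eq_add_neg]; exact hs
      exact h1.le.trans (Finset.single_le_sum
        (f := fun s => ‖f (y + torusLine w t + torusLine w (-s))‖ ^ 2)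
        (fun _ _ => by positivity) hsJ))
  rw [hsum, Complex.zero_re] at hle
  linarith

/-- Uniqueness of Fourier coefficients along a line. -/
theorem eq_zero_of_torusMean_eq_zero {f : C(UnitAddTorus (Fin k), ℂ)}
    {y : UnitAddTorus (Fin k)} {w : Fin k → ℝ} (h : ∀ a, torusMean y w a f = 0) : f y = 0 := by
  refine eq_zero_of_torusMean_star_mul_self (w := w) ?_
  -- Vanishing coefficients make the zero-frequency mean of `g * f` vanish for every character `g`,
  -- hence for `g = star f`.
  refine torus_induction (P := fun g => torusMean y w 0 (g * f) = 0) ?_ ?_ ?_ ?_ (star f)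
  · exact isClosed_eq (by fun_prop) (by fun_prop)
  · intro m; rw [torusMean_mFourier_mul, h, mul_zero]
  · intro g g' hg hg'; rw [add_mul, map_add, hg, hg', add_zero]
  · intro c g hg; rw [smul_mul_assoc, map_smul, hg, smul_zero]

end

noncomputable section

/-! ## The cocycle of the two-sided series -/

variable {k : ℕ}

theorem torusAct_mul (M N : Matrix.GeneralLinearGroup (Fin k) ℤ) (y : UnitAddTorus (Fin k)) :
    torusAct (M * N) y = torusAct M (torusAct N y) := by
  ext l
  simp only [torusAct, Units.val_mul, Matrix.mul_apply, Finset.sum_smul, Finset.smul_sum, mul_smul]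
  exact Finset.sum_comm

theorem torusAct_one (y : UnitAddTorus (Fin k)) : torusAct 1 y = y := by
  ext l
  simp [torusAct, Matrix.one_apply, ite_smul]

theorem torusAct_add (M : Matrix.GeneralLinearGroup (Fin k) ℤ) (y z : UnitAddTorus (Fin k)) :
    torusAct M (y + z) = torusAct M y + torusAct M z := by
  ext l
  simp [torusAct, Finset.sum_add_distrib]

theorem torusAct_torusProj (M : Matrix.GeneralLinearGroup (Fin k) ℤ) (z : Fin k → ℝ) :
    torusAct M (torusProj z) =
      torusProj (((M : Matrix (Fin k) (Fin k) ℤ).map (Int.cast : ℤ → ℝ)).mulVec z) := by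
  ext l
  simp only [torusAct, torusProj, Matrix.mulVec, dotProduct, Matrix.map_apply]
  rw [← QuotientAddGroup.mk'_apply (AddSubgroup.zmultiples (1 : ℝ)), map_sum]
  refine Finset.sum_congr rfl fun m _ => ?_
  rw [← zsmul_eq_mul, map_zsmul]
  rfl

@[fun_prop]
theorem continuous_torusAct (M : Matrix.GeneralLinearGroup (Fin k) ℤ) :
    Continuous (torusAct M) := by
  unfold torusAct
  fun_prop

/-- A matrix with a contracted eigendirection `w`, together with a function on the torus that is
continuously differentiable along `w` with bounded derivative. -/
structure SliceData (k : ℕ) where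
  A : Matrix.GeneralLinearGroup (Fin k) ℤ
  w : Fin k → ℝ
  b : ℝ
  lam : ℝ
  p : C(UnitAddTorus (Fin k), ℝ)
  L : ℝ
  mulVec_w : ((A : Matrix (Fin k) (Fin k) ℤ).map (Int.cast : ℤ → ℝ)).mulVec w = b • w
  b_ne_zero : b ≠ 0
  lam_pos : 0 < lam
  lam_lt_one : lam < 1
  b_lt_lam : |b| < lam
  contDiff_line : ∀ y, ContDiff ℝ 1 fun t => p (y + torusLine w t)
  deriv_line_le : ∀ y t, |deriv (fun t => p (y + torusLine w t)) t| ≤ L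

namespace SliceData

variable (D : SliceData k)

/-- The action of `A ^ n` on the torus. -/
def act (n : ℤ) (y : UnitAddTorus (Fin k)) : UnitAddTorus (Fin k) := torusAct (D.A ^ n) y

@[fun_prop]
theorem continuous_act (n : ℤ) : Continuous (D.act n) := continuous_torusAct _

theorem act_act (m n : ℤ) (y : UnitAddTorus (Fin k)) : D.act m (D.act n y) = D.act (m + n) y := by
  rw [act, act, act, zpow_add, torusAct_mul]

theorem act_zero (y : UnitAddTorus (Fin k)) : D.act 0 y = y := by
  rw [act, zpow_zero, torusAct_one]

theorem act_line (n : ℤ) (t : ℝ) : D.act n (torusLine D.w t) = torusLine D.w (D.b ^ n * t) := by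
  have h1 : ∀ t, D.act 1 (torusLine D.w t) = torusLine D.w (D.b * t) := fun t => by
    rw [act, zpow_one, torusLine, torusAct_torusProj, Matrix.mulVec_smul, D.mulVec_w, smul_smul,
      mul_comm]
    rfl
  induction n using Int.induction_on generalizing t with
  | zero => rw [act_zero, zpow_zero, one_mul]
  | succ n ih => rw [← D.act_act, h1, ih, zpow_add_one₀ D.b_ne_zero, mul_assoc]
  | pred n ih =>
    have : torusLine D.w t = D.act 1 (torusLine D.w (D.b⁻¹ * t)) := by
      rw [h1, mul_inv_cancel_left₀ D.b_ne_zero]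
    rw [this, act_act, sub_add_cancel, ih, zpow_sub_one₀ D.b_ne_zero, mul_assoc]

theorem act_add_line (n : ℤ) (y : UnitAddTorus (Fin k)) (t : ℝ) :
    D.act n (y + torusLine D.w t) = D.act n y + torusLine D.w (D.b ^ n * t) := by
  rw [← act_line, act, torusAct_add]
  rfl

theorem L_nonneg : 0 ≤ D.L := (abs_nonneg _).trans (D.deriv_line_le 0 0)

theorem abs_p_sub_le (y : UnitAddTorus (Fin k)) (t : ℝ) :
    |D.p (y + torusLine D.w t) - D.p y| ≤ D.L * |t| := by
  have h := Convex.norm_image_sub_le_of_norm_deriv_le (f := fun t => D.p (y + torusLine D.w t))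
    (s := Set.univ) (x := 0) (y := t)
    (fun z _ => (D.contDiff_line y).differentiable one_ne_zero z)
    (fun z _ => D.deriv_line_le y z) convex_univ trivial trivial
  simpa [torusLine_zero] using h

/-- The terms of `cocycle`. -/
def incr (n : ℤ) (s : ℝ) : C(UnitAddTorus (Fin k), ℝ) where
  toFun y := D.lam ^ n * (D.p (D.act (-n) (y + torusLine D.w s)) - D.p (D.act (-n) y))
  continuous_toFun := by fun_prop

theorem incr_apply (n : ℤ) (s : ℝ) (y : UnitAddTorus (Fin k)) : D.incr n s y =
    D.lam ^ n * (D.p (D.act (-n) (y + torusLine D.w s)) - D.p (D.act (-n) y)) := rfl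

theorem abs_incr_natCast_le (n : ℕ) (s : ℝ) (y : UnitAddTorus (Fin k)) :
    |D.incr n s y| ≤ 2 * ‖D.p‖ * D.lam ^ n := by
  have := D.lam_pos
  rw [incr_apply, abs_mul, zpow_natCast, abs_of_pos (by positivity), mul_comm]
  gcongr
  refine (abs_sub _ _).trans ?_
  have h1 := D.p.norm_coe_le_norm (D.act (-n) (y + torusLine D.w s))
  have h2 := D.p.norm_coe_le_norm (D.act (-n) y)
  rw [Real.norm_eq_abs] at h1 h2
  linarith

/-- The weight `λ^{-(n+1)}` is beaten by the contraction `|b|^{n+1}` of the displacement. -/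
theorem abs_incr_neg_le (n : ℕ) (s : ℝ) (y : UnitAddTorus (Fin k)) :
    |D.incr (-(n + 1)) s y| ≤ D.L * (|D.b| / D.lam) ^ (n + 1) * |s| := by
  have := D.lam_pos
  have e : ((n : ℤ) + 1) = ((n + 1 : ℕ) : ℤ) := by push_cast; rfl
  rw [incr_apply, abs_mul, neg_neg, act_add_line, zpow_neg, e, zpow_natCast, zpow_natCast,
    abs_of_pos (by positivity)]
  calc _ ≤ (D.lam ^ (n + 1))⁻¹ * (D.L * |D.b ^ (n + 1) * s|) := by
        gcongr; exact D.abs_p_sub_le _ _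
    _ = _ := by rw [abs_mul, abs_pow, div_pow]; ring

theorem ratio_lt_one : |D.b| / D.lam < 1 := (div_lt_one D.lam_pos).2 D.b_lt_lam

theorem ratio_nonneg : 0 ≤ |D.b| / D.lam := div_nonneg (abs_nonneg _) D.lam_pos.le

theorem summable_ratio : Summable fun n : ℕ => D.L * (|D.b| / D.lam) ^ (n + 1) :=
  ((summable_nat_add_iff 1).2
    (summable_geometric_of_lt_one D.ratio_nonneg D.ratio_lt_one)).mul_left _

/-- A summable bound for the terms of `cocycle`. -/
def incrBound (n : ℤ) : ℝ :=
  if 0 ≤ n then 2 * ‖D.p‖ * D.lam ^ n else D.L * (|D.b| / D.lam) ^ (-n)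

theorem summable_incrBound : Summable D.incrBound := by
  refine Summable.of_nat_of_neg_add_one ?_ ?_
  · simp only [incrBound, Int.natCast_nonneg, if_true, zpow_natCast]
    exact (summable_geometric_of_lt_one D.lam_pos.le D.lam_lt_one).mul_left _
  · refine D.summable_ratio.congr fun n => ?_
    rw [incrBound, if_neg (by omega), neg_neg]
    norm_cast

theorem norm_incr_le (n : ℤ) (s : ℝ) : ‖D.incr n s‖ ≤ D.incrBound n * (1 + |s|) := by
  -- One half of the series is bounded independently of `s`, the other linearly in `|s|`; the factor
  -- `1 + |s|` dominates both.
  have h1 : ∀ x : ℝ, 0 ≤ x → x ≤ x * (1 + |s|) ∧ x * |s| ≤ x * (1 + |s|) := fun x hx => by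
    constructor <;> nlinarith [abs_nonneg s]
  have := D.lam_pos
  have := D.ratio_nonneg
  have := D.L_nonneg
  have h0 : 0 ≤ D.incrBound n := by
    unfold incrBound
    split_ifs <;> positivity
  rw [ContinuousMap.norm_le _ (by positivity)]
  intro y
  rw [Real.norm_eq_abs]
  rcases le_or_gt 0 n with hn | hn
  · lift n to ℕ using hn
    refine ((D.abs_incr_natCast_le n s y).trans_eq ?_).trans (h1 _ h0).1
    rw [incrBound, if_pos (Int.natCast_nonneg n), zpow_natCast]
  · obtain ⟨m, rfl⟩ : ∃ m : ℕ, n = -(m + 1) := ⟨(-n - 1).toNat, by omega⟩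
    refine ((D.abs_incr_neg_le m s y).trans_eq ?_).trans (h1 _ h0).2
    rw [incrBound, if_neg (by omega), neg_neg]
    norm_cast

theorem summable_incr (s : ℝ) : Summable fun n => D.incr n s :=
  (D.summable_incrBound.mul_right _).of_norm_bounded fun n => D.norm_incr_le n s

/-- The sum over `n : ℤ` of `λ^n (p(A^{-n}(y + s w)) - p(A^{-n} y))`, as a function of `y`. -/
def cocycle (s : ℝ) : C(UnitAddTorus (Fin k), ℝ) := ∑' n, D.incr n s

theorem hasSum_cocycle (s : ℝ) (y : UnitAddTorus (Fin k)) :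
    HasSum (fun n => D.incr n s y) (D.cocycle s y) :=
  ContinuousMap.hasSum_apply (D.summable_incr s).hasSum y

theorem cocycle_add_line (s t : ℝ) (y : UnitAddTorus (Fin k)) :
    D.cocycle s (y + torusLine D.w t) = D.cocycle (s + t) y - D.cocycle t y := by
  refine (D.hasSum_cocycle s _).unique ?_
  refine ((D.hasSum_cocycle (s + t) y).sub (D.hasSum_cocycle t y)).congr_fun ?_
  intro n
  rw [incr_apply, incr_apply, incr_apply, add_comm s t, torusLine_add, add_assoc]
  ring

/-- Reindexing by `n ↦ n + m`, which is available only because the sum is two-sided. -/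
theorem cocycle_zpow_mul (m : ℤ) (s : ℝ) (y : UnitAddTorus (Fin k)) :
    D.cocycle (D.b ^ m * s) y = D.lam ^ m * D.cocycle s (D.act (-m) y) := by
  have h := (Equiv.addRight m).hasSum_iff.2 (D.hasSum_cocycle (D.b ^ m * s) y)
  refine h.unique (((D.hasSum_cocycle s (D.act (-m) y)).mul_left (D.lam ^ m)).congr_fun ?_)
  intro n
  have e : ∀ z, D.act (-(n + m)) z = D.act (-n) (D.act (-m) z) := fun z => by
    rw [act_act]; congr 1; ring
  have e2 : D.b ^ (-m) * (D.b ^ m * s) = s := by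
    rw [← mul_assoc, ← zpow_add₀ D.b_ne_zero]; simp
  simp only [Function.comp_apply, Equiv.coe_addRight, incr_apply, e, zpow_add₀ D.lam_pos.ne']
  rw [D.act_add_line (-m), e2]
  ring

theorem exists_abs_cocycle_le : ∃ K : ℝ, 0 ≤ K ∧ ∀ s y, |s| ≤ 1 → |D.cocycle s y| ≤ K := by
  refine ⟨∑' n, D.incrBound n * 2, ?_, fun s y hs => ?_⟩
  · refine tsum_nonneg fun n => ?_
    have := (norm_nonneg _).trans (D.norm_incr_le n 1)
    norm_num at this
    linarith
  · have h : ‖∑' n, D.incr n s y‖ ≤ ∑' n, D.incrBound n * 2 := by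
      refine tsum_of_norm_bounded (D.summable_incrBound.mul_right 2).hasSum fun n => ?_
      refine ((D.incr n s).norm_coe_le_norm y).trans ((D.norm_incr_le n s).trans ?_)
      have := (norm_nonneg _).trans (D.norm_incr_le n 0)
      norm_num at this
      gcongr
      linarith
    rwa [(D.hasSum_cocycle s y).tsum_eq] at h

/-- The terms of negative index of `cocycle`. -/
def negPart (y : UnitAddTorus (Fin k)) (s : ℝ) : ℝ := ∑' n : ℕ, D.incr (-(n + 1)) s y

theorem summable_incr_neg (s : ℝ) (y : UnitAddTorus (Fin k)) :
    Summable fun n : ℕ => D.incr (-(n + 1)) s y :=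
  (D.summable_ratio.mul_right |s|).of_norm_bounded fun n => D.abs_incr_neg_le n s y

theorem abs_negPart_le (y : UnitAddTorus (Fin k)) (s : ℝ) :
    |D.negPart y s| ≤ (∑' n : ℕ, D.L * (|D.b| / D.lam) ^ (n + 1)) * |s| := by
  rw [← tsum_mul_right]
  exact tsum_of_norm_bounded (f := fun n : ℕ => D.incr (-(n + 1)) s y)
    (D.summable_ratio.mul_right |s|).hasSum fun n => D.abs_incr_neg_le n s y

/-- The sum `φ(y) = ∑_{n ≥ 0} λ^n p(A^{-n} y)`. -/
def phi (y : UnitAddTorus (Fin k)) : ℝ := skewPhi D.A D.lam D.p y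

theorem hasSum_phi (y : UnitAddTorus (Fin k)) :
    HasSum (fun n : ℕ => D.lam ^ n * D.p (D.act (-n) y)) (D.phi y) := by
  refine Summable.hasSum (Summable.of_norm_bounded (g := fun n : ℕ => D.lam ^ n * ‖D.p‖)
    ((summable_geometric_of_lt_one D.lam_pos.le D.lam_lt_one).mul_right _) fun n => ?_)
  have := D.lam_pos
  rw [norm_mul, norm_pow, Real.norm_of_nonneg D.lam_pos.le]
  gcongr
  exact D.p.norm_coe_le_norm _

/-- The terms with `n ≥ 0` of the cocycle are exactly the increment of `phi`. -/
theorem phi_add_line_sub (y : UnitAddTorus (Fin k)) (s : ℝ) :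
    D.phi (y + torusLine D.w s) - D.phi y = D.cocycle s y - D.negPart y s := by
  have h1 : HasSum (fun n : ℕ => D.incr n s y) (D.phi (y + torusLine D.w s) - D.phi y) := by
    refine ((D.hasSum_phi (y + torusLine D.w s)).sub (D.hasSum_phi y)).congr_fun fun n => ?_
    rw [incr_apply, zpow_natCast, mul_sub]
  have h2 := HasSum.of_nat_of_neg_add_one (f := fun n => D.incr n s y) h1
    (D.summable_incr_neg s y).hasSum
  rw [(D.hasSum_cocycle s y).unique h2, negPart]
  ring

/-- Termwise differentiation: the chain rule brings out `b^{n+1}`, so the derivatives are dominated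
by a geometric series of ratio `|b| / λ`. -/
theorem contDiff_negPart (y : UnitAddTorus (Fin k)) : ContDiff ℝ 1 (D.negPart y) := by
  set q : ℕ → ℝ → ℝ := fun n t => D.p (D.act (n + 1) y + torusLine D.w t) with hq
  set g' : ℕ → ℝ → ℝ := fun n t =>
    (D.lam ^ (n + 1))⁻¹ * (deriv (q n) (D.b ^ (n + 1) * t) * D.b ^ (n + 1)) with hg'
  have hterm : ∀ (n : ℕ) (t : ℝ), D.incr (-(n + 1)) t y =
      (D.lam ^ (n + 1))⁻¹ * (q n (D.b ^ (n + 1) * t) - D.p (D.act (n + 1) y)) := by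
    intro n t
    rw [incr_apply, neg_neg, act_add_line, zpow_neg]
    norm_cast
  have hder : ∀ (n : ℕ) (t : ℝ), HasDerivAt (fun t => D.incr (-(n + 1)) t y) (g' n t) t := by
    intro n t
    simp only [hterm]
    refine HasDerivAt.const_mul _ (HasDerivAt.sub_const _ ?_)
    have h1 := ((D.contDiff_line (D.act (n + 1) y)).differentiable one_ne_zero
      (D.b ^ (n + 1) * t)).hasDerivAt
    have h2 := (hasDerivAt_id t).const_mul (D.b ^ (n + 1))
    rw [mul_one] at h2
    exact HasDerivAt.comp t h1 h2
  have hcont : ∀ n, Continuous (g' n) := by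
    intro n
    have := (D.contDiff_line (D.act (n + 1) y)).continuous_deriv le_rfl
    simp only [hg']
    fun_prop
  have hbound : ∀ n t, ‖g' n t‖ ≤ D.L * (|D.b| / D.lam) ^ (n + 1) := by
    intro n t
    have := D.lam_pos
    rw [Real.norm_eq_abs, abs_mul, abs_mul, abs_of_pos (by positivity), abs_pow]
    calc _ ≤ (D.lam ^ (n + 1))⁻¹ * (D.L * |D.b| ^ (n + 1)) := by
          gcongr; exact D.deriv_line_le _ _
      _ = _ := by rw [div_pow]; ring
  have h := hasDerivAt_tsum D.summable_ratio hder hbound (y₀ := 0) (D.summable_incr_neg 0 y)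
  rw [contDiff_one_iff_deriv]
  refine ⟨fun t => (h t).differentiableAt, ?_⟩
  rw [show deriv (D.negPart y) = fun t => ∑' n, g' n t from funext fun t => (h t).deriv]
  exact continuous_tsum hcont D.summable_ratio hbound

end SliceData

end

noncomputable section

open UnitAddTorus

/-! ## Fourier coefficients of the two-sided series -/

variable {k : ℕ}

/-- The complexification of a real continuous function. -/
def complexify : C(UnitAddTorus (Fin k), ℝ) →L[ℝ] C(UnitAddTorus (Fin k), ℂ) :=
  Complex.ofRealCLM.compLeftContinuous ℝ _

theorem complexify_apply (f : C(UnitAddTorus (Fin k), ℝ)) (y : UnitAddTorus (Fin k)) :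
    complexify f y = f y := rfl

theorem apFourierCoeff_lineRestr (f : C(UnitAddTorus (Fin k), ℝ)) (y : UnitAddTorus (Fin k))
    (w : Fin k → ℝ) (a : ℝ) :
    apFourierCoeff (lineRestr f y w) a = torusMean y w a (complexify f) := rfl

namespace SliceData

variable (D : SliceData k)

/-- The terms of the Fourier coefficients of the two-sided series along the line through `y`. -/
def term (y : UnitAddTorus (Fin k)) (σ : ℝ) (n : ℤ) : ℂ := gTerm D.A D.lam D.p y D.b D.w σ n

/-- `A^{-n}` maps the line through `y` to the line through `A^{-n} y`, rescaled by `b^{-n}`. Undoing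
the rescaling turns frequency `σ b^n` into `σ`, so all terms become means along the same line at the
same frequency. -/
theorem term_eq (y : UnitAddTorus (Fin k)) (σ : ℝ) (n : ℤ) : D.term y σ n =
    (D.lam : ℂ) ^ n * torusMean y D.w σ (complexify (D.p.comp ⟨D.act (-n), by fun_prop⟩)) := by
  have h0 : D.b ^ (-n) ≠ 0 := zpow_ne_zero _ D.b_ne_zero
  have h1 : torusMean y D.w σ (complexify (D.p.comp ⟨D.act (-n), by fun_prop⟩)) =
      torusMean (D.act (-n) y) (D.b ^ (-n) • D.w) σ (complexify D.p) := by
    refine torusMean_congr (fun t => ?_) σ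
    rw [torusLine_smul, mul_comm t, complexify_apply, complexify_apply, ← D.act_add_line]
    rfl
  have h2 : σ * D.b ^ n * D.b ^ (-n) = σ := by
    rw [mul_assoc, ← zpow_add₀ D.b_ne_zero, add_neg_cancel, zpow_zero, mul_one]
  have h3 := torusMean_smul_dir (D.act (-n) y) D.w (σ * D.b ^ n) h0
  rw [h2] at h3
  rw [h1, h3, term, gTerm, apFourierCoeff_lineRestr]
  rfl

/-- The mean is a continuous functional and the cocycle series converges in sup norm. Each increment
is a translate minus the original, whence the factor `e^{iσs} - 1`. -/
theorem hasSum_term_mul (y : UnitAddTorus (Fin k)) (σ s : ℝ) :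
    HasSum (fun n => D.term y σ n * (Complex.exp (Complex.I * σ * s) - 1))
      (torusMean y D.w σ (complexify (D.cocycle s))) := by
  have h := ((D.summable_incr s).hasSum.mapL complexify).mapL (torusMean y D.w σ)
  refine h.congr_fun fun n => ?_
  have e : complexify (D.incr n s) = (D.lam : ℂ) ^ n •
      (torusShift (torusLine D.w s) (complexify (D.p.comp ⟨D.act (-n), by fun_prop⟩)) -
        complexify (D.p.comp ⟨D.act (-n), by fun_prop⟩)) := by
    ext z
    rw [complexify_apply, incr_apply]
    push_cast
    rfl
  rw [e, map_smul, map_sub, torusMean_shift, term_eq, smul_eq_mul]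
  ring

theorem exp_half_period {σ : ℝ} (hσ : σ ≠ 0) :
    Complex.exp (Complex.I * σ * (Real.pi / σ : ℝ)) - 1 = -2 := by
  have : (σ : ℂ) ≠ 0 := by exact_mod_cast hσ
  have e : Complex.I * σ * (Real.pi / σ : ℝ) = Real.pi * Complex.I := by
    push_cast
    field_simp
  rw [e, Complex.exp_pi_mul_I]
  norm_num

/-- At `s = π / σ` the factor `e^{iσs} - 1` equals `-2` and can be divided out. -/
theorem summable_term (y : UnitAddTorus (Fin k)) {σ : ℝ} (hσ : σ ≠ 0) :
    Summable (D.term y σ) := by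
  have h := (D.hasSum_term_mul y σ (Real.pi / σ)).summable
  rw [exp_half_period hσ] at h
  exact (summable_mul_right_iff (by norm_num)).1 h

theorem torusMean_cocycle (y : UnitAddTorus (Fin k)) {σ : ℝ} (hσ : σ ≠ 0) (s : ℝ) :
    torusMean y D.w σ (complexify (D.cocycle s)) =
      (∑' n, D.term y σ n) * (Complex.exp (Complex.I * σ * s) - 1) :=
  (D.hasSum_term_mul y σ s).unique ((D.summable_term y hσ).hasSum.mul_right _)

theorem cocycle_line_eq_zero {y : UnitAddTorus (Fin k)} (h : ∀ s, D.cocycle s y = 0) (s t : ℝ) :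
    D.cocycle s (y + torusLine D.w t) = 0 := by
  rw [cocycle_add_line, h, h, sub_zero]

theorem cocycle_eq_zero_iff (y : UnitAddTorus (Fin k)) :
    (∀ s, D.cocycle s y = 0) ↔ ∀ σ : ℝ, σ ≠ 0 → ∑' n, D.term y σ n = 0 := by
  constructor
  · intro h σ hσ
    have h1 := D.torusMean_cocycle y hσ (Real.pi / σ)
    have h2 : torusMean y D.w σ (complexify (D.cocycle (Real.pi / σ))) =
        torusMean y D.w σ 0 := by
      refine torusMean_congr (fun t => ?_) σ
      rw [complexify_apply, D.cocycle_line_eq_zero h]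
      simp
    rw [h2, map_zero, exp_half_period hσ] at h1
    exact (mul_eq_zero.1 h1.symm).resolve_right (by norm_num)
  · intro h s
    have : complexify (D.cocycle s) y = 0 := by
      refine eq_zero_of_torusMean_eq_zero (w := D.w) fun σ => ?_
      -- At frequency `0` the factor `e^{iσs} - 1` vanishes, so no condition on the coefficient is
      -- needed.
      by_cases hσ : σ = 0
      · refine (D.hasSum_term_mul y σ s).unique ?_
        simp [hσ]
      · rw [D.torusMean_cocycle y hσ, h σ hσ, zero_mul]
    rwa [complexify_apply, Complex.ofReal_eq_zero] at this

/-! ## Oscillation -/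

/-- If the cocycle vanished at `y` for all `s`, its quadratic mean along the line through `y` would
vanish. That mean agrees with the one through `A^l x`, so the cocycle would vanish at `A^l x` and,
by scaling, at `x`. -/
theorem exists_cocycle_ne_zero {x y : UnitAddTorus (Fin k)} {l : ℤ}
    (hx : ¬ ∀ s, D.cocycle s x = 0)
    (hy : ∀ m, lineFreq m D.w = 0 → mFourier m y = mFourier m (D.act l x)) :
    ∃ s, D.cocycle s y ≠ 0 := by
  by_contra! h
  refine hx fun s => ?_
  have h1 : ∀ s, D.cocycle s (D.act l x) = 0 := fun s => by
    have : complexify (D.cocycle s) (D.act l x) = 0 := by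
      refine eq_zero_of_torusMean_star_mul_self (w := D.w) ?_
      rw [← torusMean_eq_of_mFourier_eq hy]
      rw [show torusMean y D.w 0 (star (complexify (D.cocycle s)) * complexify (D.cocycle s)) =
        torusMean y D.w 0 0 from torusMean_congr (fun t => ?_) 0, map_zero]
      rw [ContinuousMap.mul_apply, complexify_apply, D.cocycle_line_eq_zero h]
      simp
    rwa [complexify_apply, Complex.ofReal_eq_zero] at this
  have h2 := D.cocycle_zpow_mul (-l) (D.b ^ l * s) x
  rwa [neg_neg, h1, mul_zero, ← mul_assoc, ← zpow_add₀ D.b_ne_zero, neg_add_cancel, zpow_zero,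
    one_mul] at h2

/-- The sets where some `|s| ≤ n` gives a value above `1 / (n + 1)` are open and increase with `n`;
compactness selects a single `n`. -/
theorem exists_uniform_cocycle_lower {S : Set (UnitAddTorus (Fin k))} (hS : IsCompact S)
    (h : ∀ y ∈ S, ∃ s, D.cocycle s y ≠ 0) :
    ∃ R c : ℝ, 0 < R ∧ 0 < c ∧ ∀ y ∈ S, ∃ s, |s| ≤ R ∧ c ≤ |D.cocycle s y| := by
  have hU : S ⊆ ⋃ n : ℕ, ⋃ (s : ℝ) (_ : |s| ≤ n), {y | 1 / ((n : ℝ) + 1) < |D.cocycle s y|} := by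
    intro y hy
    obtain ⟨s, hs⟩ := h y hy
    obtain ⟨n, hn⟩ := exists_nat_one_div_lt (abs_pos.2 hs)
    obtain ⟨m, hm⟩ := exists_nat_ge |s|
    simp only [Set.mem_iUnion]
    refine ⟨max n m, s, hm.trans (by exact_mod_cast le_max_right n m), lt_of_le_of_lt ?_ hn⟩
    refine one_div_le_one_div_of_le (by positivity) ?_
    have : (n : ℝ) ≤ (max n m : ℕ) := by exact_mod_cast le_max_left n m
    linarith
  obtain ⟨n, hn⟩ := hS.elim_directed_cover _ (fun n => isOpen_iUnion fun s => isOpen_iUnion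
    fun _ => isOpen_lt continuous_const (by fun_prop)) hU (by
      refine Monotone.directed_le fun n m hnm => ?_
      have hnm' : (n : ℝ) ≤ m := by exact_mod_cast hnm
      intro y hy
      simp only [Set.mem_iUnion] at hy ⊢
      obtain ⟨s, hs, hy⟩ := hy
      refine ⟨s, hs.trans hnm', lt_of_le_of_lt (b := 1 / ((n : ℝ) + 1)) ?_ hy⟩
      exact one_div_le_one_div_of_le (by positivity) (by linarith))
  refine ⟨n + 1, 1 / (n + 1), by positivity, by positivity, fun y hy => ?_⟩
  have := hn hy
  simp only [Set.mem_iUnion] at this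
  obtain ⟨s, hs, hy⟩ := this
  exact ⟨s, by linarith, le_of_lt hy⟩

/-- The compact set consists of the points sharing with some `A^l x`, `l ∈ Λ`, the values of all
characters constant along `w`. It contains every `A^{-n}(x + t w)`, so the uniform bound there
rescales to size `|b|^n` at `x + t w`. -/
theorem exists_cocycle_lower {x : UnitAddTorus (Fin k)} {Λ : Finset ℤ}
    (hΛ : ∀ n, ∃ l ∈ Λ, ∀ m, lineFreq m D.w = 0 → mFourier m (D.act n x) = mFourier m (D.act l x))
    (hx : ¬ ∀ s, D.cocycle s x = 0) :
    ∃ R c : ℝ, 0 < R ∧ 0 < c ∧ ∀ (n : ℕ) (t : ℝ),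
      ∃ s, |s| ≤ R * |D.b| ^ n ∧ c * D.lam ^ n ≤ |D.cocycle s (x + torusLine D.w t)| := by
  have hS : IsCompact (⋃ l ∈ Λ, {y | ∀ m, lineFreq m D.w = 0 →
      mFourier m y = mFourier m (D.act l x)}) := by
    refine Λ.isCompact_biUnion fun l _ => IsClosed.isCompact ?_
    simp only [Set.ofPred_forall]
    exact isClosed_iInter fun m => isClosed_iInter fun _ => isClosed_eq (by fun_prop) (by fun_prop)
  obtain ⟨R, c, hR, hc, h⟩ := D.exists_uniform_cocycle_lower hS (by
    intro y hy
    simp only [Set.mem_iUnion] at hy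
    obtain ⟨l, _, hy⟩ := hy
    exact D.exists_cocycle_ne_zero hx hy)
  refine ⟨R, c, hR, hc, fun n t => ?_⟩
  obtain ⟨s, hs, hcs⟩ := h (D.act (-n) (x + torusLine D.w t)) (by
    obtain ⟨l, hl, h⟩ := hΛ (-n)
    simp only [Set.mem_iUnion]
    refine ⟨l, hl, fun m hm => ?_⟩
    rw [← h m hm, act_add_line, mFourier_add_apply, mFourier_torusLine, hm]
    simp)
  refine ⟨D.b ^ (n : ℤ) * s, ?_, ?_⟩
  · rw [abs_mul, zpow_natCast, abs_pow, mul_comm]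
    gcongr
  · have := D.lam_pos
    rw [cocycle_zpow_mul, abs_mul, zpow_natCast, abs_of_pos (by positivity), mul_comm]
    gcongr

/-! ### Hölder bounds and box dimension of the slices -/

/-- The Hölder exponent of the slices. -/
def expo : ℝ := Real.log D.lam / Real.log |D.b|

theorem abs_b_pos : 0 < |D.b| := abs_pos.2 D.b_ne_zero

theorem abs_b_lt_one : |D.b| < 1 := D.b_lt_lam.trans D.lam_lt_one

theorem expo_pos : 0 < D.expo :=
  div_pos_of_neg_of_neg (Real.log_neg D.lam_pos D.lam_lt_one)
    (Real.log_neg D.abs_b_pos D.abs_b_lt_one)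

theorem expo_lt_one : D.expo < 1 := by
  rw [expo, div_lt_one_of_neg (Real.log_neg D.abs_b_pos D.abs_b_lt_one)]
  exact Real.log_lt_log D.abs_b_pos D.b_lt_lam

theorem rpow_expo (n : ℕ) : (|D.b| ^ n) ^ D.expo = D.lam ^ n := by
  rw [← Real.rpow_natCast, ← Real.rpow_mul D.abs_b_pos.le, mul_comm, Real.rpow_mul D.abs_b_pos.le,
    Real.rpow_natCast]
  congr 1
  rw [Real.rpow_def_of_pos D.abs_b_pos, expo, mul_div_cancel₀ _
    (Real.log_neg D.abs_b_pos D.abs_b_lt_one).ne, Real.exp_log D.lam_pos]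

/-- Choose `n` with `|b|^{n+1} < |s| ≤ |b|^n` and rescale to `|s / b^n| ≤ 1`. The factor `λ⁻¹` pays
for passing from `λ^n` to `λ^{n+1}`. -/
theorem exists_cocycle_holder : ∃ C : ℝ, 0 ≤ C ∧ ∀ s y, |s| ≤ 1 →
    |D.cocycle s y| ≤ C * |s| ^ D.expo := by
  obtain ⟨K, hK, h⟩ := D.exists_abs_cocycle_le
  have hl := D.lam_pos
  refine ⟨K * D.lam⁻¹, by positivity, fun s y hs => ?_⟩
  by_cases hs0 : s = 0
  · have := D.cocycle_add_line 0 0 y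
    rw [torusLine_zero, add_zero, add_zero, sub_self] at this
    rw [hs0, this, abs_zero]
    positivity
  obtain ⟨n, hn1, hn2⟩ := exists_nat_pow_near_of_lt_one (abs_pos.2 hs0) hs D.abs_b_pos
    D.abs_b_lt_one
  have hbn : D.b ^ n ≠ 0 := pow_ne_zero _ D.b_ne_zero
  have e : s = D.b ^ (n : ℤ) * (s / D.b ^ n) := by
    rw [zpow_natCast, mul_div_cancel₀ _ hbn]
  have h1 : |s / D.b ^ n| ≤ 1 := by
    rw [abs_div, abs_pow]
    exact div_le_one_of_le₀ hn2 (by positivity)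
  have h2 : |D.cocycle s y| ≤ D.lam ^ n * K := by
    rw [e, cocycle_zpow_mul, abs_mul, zpow_natCast, abs_of_pos (by positivity)]
    gcongr
    exact h _ _ h1
  refine h2.trans ?_
  have h3 : D.lam ^ (n + 1) ≤ |s| ^ D.expo := by
    rw [← rpow_expo]
    exact Real.rpow_le_rpow (by positivity) hn1.le D.expo_pos.le
  calc D.lam ^ n * K = K * D.lam⁻¹ * D.lam ^ (n + 1) := by
        field_simp
        ring
    _ ≤ _ := by gcongr

/-- The slice of `phi` through `x`. -/
def slice (x : UnitAddTorus (Fin k)) (t : ℝ) : ℝ := D.phi (x + torusLine D.w t)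

theorem slice_sub (x : UnitAddTorus (Fin k)) (s t : ℝ) :
    D.slice x t - D.slice x s = D.cocycle (t - s) (x + torusLine D.w s) -
      D.negPart (x + torusLine D.w s) (t - s) := by
  rw [← phi_add_line_sub, slice, slice, add_assoc, ← torusLine_add, add_sub_cancel]

theorem exists_negPart_le : ∃ M : ℝ, 0 < M ∧ ∀ y s, |D.negPart y s| ≤ M * |s| := by
  refine ⟨(∑' n : ℕ, D.L * (|D.b| / D.lam) ^ (n + 1)) + 1, ?_, fun y s => ?_⟩
  · have : 0 ≤ ∑' n : ℕ, D.L * (|D.b| / D.lam) ^ (n + 1) := tsum_nonneg fun n =>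
      mul_nonneg D.L_nonneg (pow_nonneg D.ratio_nonneg _)
    linarith
  · refine (D.abs_negPart_le y s).trans ?_
    gcongr
    linarith

theorem slice_of_cocycle_eq_zero {x : UnitAddTorus (Fin k)} (h : ∀ s, D.cocycle s x = 0) :
    ContDiff ℝ 1 (D.slice x) ∧ ∀ a b : ℝ, a < b → HasBoxDim (graphOver (D.slice x) a b) 1 := by
  constructor
  · have : D.slice x = fun t => D.phi x - D.negPart x t := by
      funext t
      have h1 := D.phi_add_line_sub x t
      rw [h] at h1
      rw [slice]
      linarith
    rw [this]
    exact contDiff_const.sub (D.contDiff_negPart x)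
  · intro a b hab
    obtain ⟨M, hM, hneg⟩ := D.exists_negPart_le
    refine hasBoxDim_graphOver_one hab hM.le fun s t _ => ?_
    rw [slice_sub, D.cocycle_line_eq_zero h, zero_sub, abs_neg]
    exact hneg _ _

theorem exists_slice_holder (x : UnitAddTorus (Fin k)) : ∃ C : ℝ, 0 ≤ C ∧
    ∀ s t, |t - s| ≤ 1 → |D.slice x t - D.slice x s| ≤ C * |t - s| ^ D.expo := by
  obtain ⟨M, hM, hneg⟩ := D.exists_negPart_le
  obtain ⟨C, hC, hhol⟩ := D.exists_cocycle_holder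
  refine ⟨C + M, by positivity, fun s t hst => ?_⟩
  rw [slice_sub, add_mul]
  refine (abs_sub _ _).trans (add_le_add (hhol _ _ hst) ((hneg _ _).trans ?_))
  gcongr
  exact Real.self_le_rpow_of_le_one (abs_nonneg _) hst D.expo_lt_one.le

theorem continuous_slice (x : UnitAddTorus (Fin k)) : Continuous (D.slice x) := by
  obtain ⟨C, hC, h⟩ := D.exists_slice_holder x
  refine continuous_iff_continuousAt.2 fun s => ?_
  rw [ContinuousAt, tendsto_iff_norm_sub_tendsto_zero]
  have hlim : Tendsto (fun t => C * |t - s| ^ D.expo) (𝓝 s) (𝓝 0) := by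
    have : Continuous fun t => C * |t - s| ^ D.expo :=
      continuous_const.mul (Continuous.rpow_const (by fun_prop) fun _ => Or.inr D.expo_pos.le)
    simpa [Real.zero_rpow D.expo_pos.ne'] using this.tendsto s
  refine squeeze_zero' (Eventually.of_forall fun _ => norm_nonneg _) ?_ hlim
  filter_upwards [Metric.closedBall_mem_nhds s one_pos] with t ht
  exact h s t ht

theorem exists_slice_osc {x : UnitAddTorus (Fin k)} {Λ : Finset ℤ}
    (hΛ : ∀ n, ∃ l ∈ Λ, ∀ m, lineFreq m D.w = 0 → mFourier m (D.act n x) = mFourier m (D.act l x))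
    (hx : ¬ ∀ s, D.cocycle s x = 0) :
    ∃ c : ℝ, 0 < c ∧ ∀ᶠ r : ℝ in 𝓝[>] 0, ∀ s : ℝ, ∃ t, |t - s| ≤ r ∧
      c * r ^ D.expo ≤ |D.slice x t - D.slice x s| := by
  obtain ⟨M, hM, hneg⟩ := D.exists_negPart_le
  obtain ⟨R, c, hR, hc, hlow⟩ := D.exists_cocycle_lower hΛ hx
  have hl := D.lam_pos
  have hRe : 0 < R ^ D.expo := Real.rpow_pos_of_pos hR _
  -- The cocycle supplies `2 c' r^α`; half of it is given up to `negPart`, which is `O(r)` and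
  -- negligible because `α < 1`.
  set c' := c * D.lam / R ^ D.expo / 2 with hc'
  have hc'0 : 0 < c' := by positivity
  refine ⟨c', hc'0, ?_⟩
  have hsmall : ∀ᶠ r : ℝ in 𝓝[>] 0, M * r ^ (1 - D.expo) < c' := by
    have h1 : Continuous fun r : ℝ => M * r ^ (1 - D.expo) :=
      continuous_const.mul (Continuous.rpow_const continuous_id
        fun _ => Or.inr (by linarith [D.expo_lt_one]))
    have h2 := h1.tendsto 0
    rw [Real.zero_rpow (by linarith [D.expo_lt_one]), mul_zero] at h2
    exact (h2.mono_left nhdsWithin_le_nhds).eventually_lt_const hc'0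
  filter_upwards [hsmall, Ioo_mem_nhdsGT hR] with r hr ⟨hr0, hrR⟩ s
  -- Here `|b|^{n+1} < r / R ≤ |b|^n`: level `n + 1` keeps the displacement below `r`, and the loss
  -- of one level is the factor `λ` in `c'`.
  obtain ⟨n, hn1, hn2⟩ := exists_nat_pow_near_of_lt_one (div_pos hr0 hR)
    (div_le_one_of_le₀ hrR.le hR.le) D.abs_b_pos D.abs_b_lt_one
  obtain ⟨u, hu1, hu2⟩ := hlow (n + 1) s
  have hur : |u| ≤ r := by
    refine hu1.trans ?_
    rw [mul_comm]
    exact ((lt_div_iff₀ hR).1 hn1).le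
  refine ⟨s + u, by rwa [add_sub_cancel_left], ?_⟩
  rw [slice_sub, add_sub_cancel_left]
  have h1 : 2 * c' * r ^ D.expo ≤ c * D.lam ^ (n + 1) := by
    have h2 : (r / R) ^ D.expo ≤ D.lam ^ n := by
      rw [← rpow_expo]
      exact Real.rpow_le_rpow (by positivity) hn2 D.expo_pos.le
    rw [Real.div_rpow hr0.le hR.le] at h2
    calc 2 * c' * r ^ D.expo = c * D.lam * (r ^ D.expo / R ^ D.expo) := by
          rw [hc']; ring
      _ ≤ c * D.lam * D.lam ^ n := by gcongr
      _ = _ := by ring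
  have h2 : |D.negPart (x + torusLine D.w s) u| ≤ c' * r ^ D.expo := by
    calc _ ≤ M * |u| := hneg _ _
      _ ≤ M * r := by gcongr
      _ = M * r ^ (1 - D.expo) * r ^ D.expo := by
        rw [mul_assoc, ← Real.rpow_add hr0, sub_add_cancel, Real.rpow_one]
      _ ≤ _ := by gcongr
  have h3 := abs_sub_abs_le_abs_sub (D.cocycle u (x + torusLine D.w s))
    (D.negPart (x + torusLine D.w s) u)
  linarith

theorem hasBoxDim_slice {x : UnitAddTorus (Fin k)} {Λ : Finset ℤ}
    (hΛ : ∀ n, ∃ l ∈ Λ, ∀ m, lineFreq m D.w = 0 → mFourier m (D.act n x) = mFourier m (D.act l x))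
    (hx : ¬ ∀ s, D.cocycle s x = 0) {a b : ℝ} (hab : a < b) :
    HasBoxDim (graphOver (D.slice x) a b) (2 - D.expo) := by
  obtain ⟨C, hC, hhol⟩ := D.exists_slice_holder x
  obtain ⟨c, hc, hosc⟩ := D.exists_slice_osc hΛ hx
  exact hasBoxDim_graphOver_of_holder_of_osc (D.continuous_slice x) hab D.expo_pos.le
    D.expo_lt_one.le hc hC hhol hosc

/-- Linear independence of the direction over `ℚ`, or periodicity of the base point, confine the
orbit to finitely many classes modulo the characters that are trivial along the direction. -/
theorem exists_finset_classes {x : UnitAddTorus (Fin k)}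
    (h : LinearIndependent ℚ D.w ∨ ∃ N : ℕ, 0 < N ∧ D.act N x = x) :
    ∃ Λ : Finset ℤ, ∀ n, ∃ l ∈ Λ, ∀ m, lineFreq m D.w = 0 →
      mFourier m (D.act n x) = mFourier m (D.act l x) := by
  rcases h with h | ⟨N, hN, hx⟩
  · refine ⟨{0}, fun n => ⟨0, Finset.mem_singleton_self 0, fun m hm => ?_⟩⟩
    -- Rational independence leaves only the trivial character constant along `w`, so a single class
    -- suffices.
    have hm0 : m = 0 := by
      have h1 : ∑ l, (m l : ℚ) • D.w l = 0 := by
        have h2 : (2 * Real.pi) ≠ 0 := by positivity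
        have h3 := (mul_eq_zero.1 hm).resolve_left h2
        simpa [Rat.smul_def] using h3
      funext l
      exact_mod_cast Fintype.linearIndependent_iff.1 h _ h1 l
    rw [hm0, mFourier_zero]
    rfl
  · refine ⟨(Finset.range N).map Nat.castEmbedding, fun n => ⟨n % N, ?_, fun m _ => ?_⟩⟩
    · have h1 := Int.emod_nonneg n (b := N) (by omega)
      have h2 := Int.emod_lt_of_pos n (b := N) (by omega)
      refine Finset.mem_map.2 ⟨(n % N).toNat, Finset.mem_range.2 (by omega), ?_⟩
      simp [Int.toNat_of_nonneg h1]
    · have hper : ∀ j : ℤ, D.act (N * j) x = x := by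
        intro j
        induction j using Int.induction_on with
        | zero => rw [mul_zero, act_zero]
        | succ j ih => rw [mul_add, mul_one, ← act_act, hx, ih]
        | pred j ih =>
          have h1 : D.act (N * (-j - 1)) (D.act N x) = x := by
            rw [act_act]
            convert ih using 2
            ring
          rwa [hx] at h1
      conv_lhs => rw [← Int.emod_add_mul_ediv n N, ← act_act, hper]

end SliceData

/-! ## Functions on the torus with continuously differentiable lift -/

theorem torusProj_surjective : Function.Surjective (torusProj : (Fin k → ℝ) → _) := by
  intro y
  choose z hz using fun l => QuotientAddGroup.mk_surjective (y l)
  exact ⟨z, funext hz⟩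

theorem isOpenQuotientMap_torusProj :
    IsOpenQuotientMap (torusProj : (Fin k → ℝ) → UnitAddTorus (Fin k)) :=
  IsOpenQuotientMap.piMap fun _ => QuotientAddGroup.isOpenQuotientMap_mk

theorem torusProj_add_intCast (z : Fin k → ℝ) (m : Fin k → ℤ) :
    torusProj (z + fun l => (m l : ℝ)) = torusProj z := by
  rw [torusProj_add]
  have : torusProj (fun l => (m l : ℝ)) = 0 := by
    ext l
    exact (AddCircle.coe_eq_zero_iff 1).2 ⟨m l, by simp⟩
  rw [this, add_zero]

/-- The derivative of the lift is `ℤ^k`-periodic, so its bound on the unit cube is global. -/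
theorem exists_norm_fderiv_lift_le {p : UnitAddTorus (Fin k) → ℝ}
    (hp : ContDiff ℝ 1 fun z : Fin k → ℝ => p (torusProj z)) :
    ∃ K : ℝ, ∀ z, ‖fderiv ℝ (fun z : Fin k → ℝ => p (torusProj z)) z‖ ≤ K := by
  have hc : Continuous (fderiv ℝ fun z : Fin k → ℝ => p (torusProj z)) :=
    hp.continuous_fderiv one_ne_zero
  obtain ⟨K, hK⟩ := (isCompact_Icc (a := (0 : Fin k → ℝ)) (b := 1)).exists_bound_of_continuousOn
    hc.continuousOn
  refine ⟨K, fun z => ?_⟩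
  have h1 := hK (z + fun l => ((-⌊z l⌋ : ℤ) : ℝ)) (by
    constructor <;> intro l <;> have h1 := Int.floor_le (z l) <;>
      have h2 := Int.lt_floor_add_one (z l) <;> simp <;> linarith)
  rw [← fderiv_comp_add_right] at h1
  simpa only [torusProj_add_intCast] using h1

theorem contDiff_lineRestr {p : UnitAddTorus (Fin k) → ℝ}
    (hp : ContDiff ℝ 1 fun z : Fin k → ℝ => p (torusProj z)) (w : Fin k → ℝ) :
    (∀ y, ContDiff ℝ 1 fun t => p (y + torusLine w t)) ∧
      ∃ L, ∀ y t, |deriv (fun t => p (y + torusLine w t)) t| ≤ L := by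
  have hlift : ∀ y, ∃ z : Fin k → ℝ, (fun t => p (y + torusLine w t)) =
      fun t : ℝ => (fun z => p (torusProj z)) (z + t • w) := by
    intro y
    obtain ⟨z, rfl⟩ := torusProj_surjective y
    exact ⟨z, funext fun t => by simp only [torusProj_add]; rfl⟩
  obtain ⟨K, hK⟩ := exists_norm_fderiv_lift_le hp
  refine ⟨fun y => ?_, K * ‖w‖, fun y t => ?_⟩
  · obtain ⟨z, hz⟩ := hlift y
    rw [hz]
    exact hp.comp (by fun_prop)
  · obtain ⟨z, hz⟩ := hlift y
    have h1 : HasDerivAt (fun t : ℝ => z + t • w) w t := by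
      simpa using ((hasDerivAt_id t).smul_const w).const_add z
    have h2 := ((hp.differentiable one_ne_zero (z + t • w)).hasFDerivAt).comp_hasDerivAt t h1
    have h3 : deriv (fun t : ℝ => (fun z => p (torusProj z)) (z + t • w)) t = _ := h2.deriv
    rw [hz, h3]
    exact ((fderiv ℝ (fun z => p (torusProj z)) (z + t • w)).le_opNorm w).trans
      (mul_le_mul_of_nonneg_right (hK _) (norm_nonneg _))

/-- The integer inverse of `A` remains an inverse over `ℝ`, so the kernel is trivial. -/
theorem eigenvalue_ne_zero (A : Matrix.GeneralLinearGroup (Fin k) ℤ) {w : Fin k → ℝ} {b : ℝ}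
    (hw : w ≠ 0)
    (h : ((A : Matrix (Fin k) (Fin k) ℤ).map (Int.cast : ℤ → ℝ)).mulVec w = b • w) : b ≠ 0 := by
  rintro rfl
  refine hw ?_
  have h1 : ((A⁻¹ : Matrix.GeneralLinearGroup (Fin k) ℤ) : Matrix (Fin k) (Fin k) ℤ).map
      (Int.cast : ℤ → ℝ) * (A : Matrix (Fin k) (Fin k) ℤ).map (Int.cast : ℤ → ℝ) = 1 := by
    have := congrArg (fun M : Matrix (Fin k) (Fin k) ℤ => M.map (Int.castRingHom ℝ))
      (Units.inv_mul A)
    rw [Matrix.map_mul, Matrix.map_one _ (map_zero _) (map_one _)] at this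
    exact this
  rw [← Matrix.one_mulVec w, ← h1, ← Matrix.mulVec_mulVec, h, zero_smul, Matrix.mulVec_zero]

end

theorem mainTheorem3 (k : ℕ) (A : Matrix.GeneralLinearGroup (Fin k) ℤ)
    (B : Fin k → ℝ) (v : Fin k → (Fin k → ℝ))
    (hBmono : StrictMono fun i => |B i|) (hBhyp : ∀ i, |B i| ≠ 1)
    (hv : LinearIndependent ℝ v)
    (hAv : ∀ i, ((A : Matrix (Fin k) (Fin k) ℤ).map (Int.cast : ℤ → ℝ)).mulVec (v i) = B i • v i)
    (lam : ℝ) (hlam0 : 0 < lam) (hlam1 : lam < 1)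
    (p : UnitAddTorus (Fin k) → ℝ)
    (hp : ContDiff ℝ ((k + 1 : ℕ) : WithTop ℕ∞) fun y : Fin k → ℝ => p (torusProj y))
    (i : Fin k) (hi : |B i| < lam)
    (x : UnitAddTorus (Fin k)) :
    -- the Fourier coefficients that enter `g_i`, and those of `g_i`, are well defined
    (∀ (n : ℤ) (a : ℝ), ∃ c : ℂ,
      Tendsto (fourierMean (lineRestr p (torusAct (A ^ (-n)) x) (v i)) a) atTop (𝓝 c)) ∧
    (∀ σ : ℝ, σ ≠ 0 → Summable (gTerm A lam p x (B i) (v i) σ)) ∧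
    -- first case: all of them vanish
    ((∀ σ : ℝ, σ ≠ 0 → gCoeff A lam p x (B i) (v i) σ = 0) →
      ContDiff ℝ 1 (subSlice A lam p x (v i)) ∧
      ∀ a b : ℝ, a < b → HasBoxDim (graphOver (subSlice A lam p x (v i)) a b) 1) ∧
    -- second case: one of them does not vanish
    ((LinearIndependent ℚ (v i) ∨ ∃ N : ℕ, 0 < N ∧ torusAct (A ^ N) x = x) →
      (∃ σ : ℝ, σ ≠ 0 ∧ gCoeff A lam p x (B i) (v i) σ ≠ 0) →
      ∀ a b : ℝ, a < b →
        HasBoxDim (graphOver (subSlice A lam p x (v i)) a b)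
          (2 - Real.log lam / Real.log |B i|)) := by
  have hp1 : ContDiff ℝ 1 fun y : Fin k → ℝ => p (torusProj y) :=
    hp.of_le (by exact_mod_cast Nat.le_add_left 1 k)
  have hpc : Continuous p := isOpenQuotientMap_torusProj.continuous_comp_iff.1 hp1.continuous
  obtain ⟨hline, L, hL⟩ := contDiff_lineRestr hp1 (v i)
  let D : SliceData k :=
    { A := A, w := v i, b := B i, lam := lam, p := ⟨p, hpc⟩, L := L
      mulVec_w := hAv i
      b_ne_zero := eigenvalue_ne_zero A (hv.ne_zero i) (hAv i)
      lam_pos := hlam0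
      lam_lt_one := hlam1
      b_lt_lam := hi
      contDiff_line := hline
      deriv_line_le := hL }
  -- `fourierMean` of `lineRestr` unfolds to `lineMean` of the complexification along `torusLine`,
  -- so the results on `SliceData` apply definitionally.
  refine ⟨fun n a => exists_tendsto_lineMean (complexify D.p) _ _ _,
    fun σ hσ => D.summable_term x hσ, fun h => ?_, fun h hg a b hab => ?_⟩
  · exact D.slice_of_cocycle_eq_zero ((D.cocycle_eq_zero_iff x).2 h)
  · obtain ⟨Λ, hΛ⟩ := D.exists_finset_classes (x := x) (h.imp_right fun ⟨N, hN, hx⟩ => ⟨N, hN, by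
      rw [SliceData.act, zpow_natCast]; exact hx⟩)
    refine D.hasBoxDim_slice hΛ (fun h0 => ?_) hab
    obtain ⟨σ, hσ, hne⟩ := hg
    exact hne ((D.cocycle_eq_zero_iff x).1 h0 σ hσ)
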